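/- \textbf{Theorem (Lie--Poisson--Jacobi reduction).} Let $G$ be a finite-dimensional real Lie group with Lie algebra $\mathfrak g=T_eG$ (with the bracket of left-invariant vector fields), and let $\mathcal L_g$ denote left translation by $g$. On $T^*G\times\mathbb R$ consider the canonical contact form $\eta=dz-\theta$, where $\theta$ is the tautological $1$-form of $T^*G$ and $z$ is the coordinate of $\mathbb R$; let $\mathcal R$ be its Reeb vector field ($\iota_{\mathcal R}d\eta=0$, $\eta(\mathcal R)=1$), let $\flat(v)=\iota_v d\eta+\eta(v)\eta$, and for a smooth function $H$ let $X_H$ be its contact Hamiltonian vector field, defined by $\flat(X_H)=dH-(H+\mathcal R(H))\,\eta$. The group $G$ acts on $T^*G\times\mathbb R$ by $g\cdot(\alpha_k,z)=(\alpha_k\circ T_{gk}\mathcal L_{g^{-1}},z)$ for $\alpha_k\in T_k^*G$. Let $$\hat J:T^*G\times\mathbb R\to\mathfrak g^*\times\mathbb R,\qquad \hat J(\alpha_g,z)=(\alpha_g\circ T_e\mathcal L_g,\,z),\quad \alpha_g\in T_g^*G .$$ On $\mathfrak g^*\times\mathbb R$ consider the Lie--Poisson--Jacobi structure $(\Lambda,E)$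 given by $E=-\partial/\partial z$ and $$\Lambda(\mu,z)(df,dk)=\Big\langle\mu,\Big[\frac{\delta f}{\delta\mu},\frac{\delta k}{\delta\mu}\Big]\Big\rangle+\Big\langle\mu,\frac{\delta f}{\delta\mu}\Big\rangle\frac{\partial k}{\partial z}-\Big\langle\mu,\frac{\delta k}{\delta\mu}\Big\rangle\frac{\partial f}{\partial z},$$ where $\delta f/\delta\mu\in\mathfrak g$ is the partial derivative of $f$ in the direction of $\mathfrak g^*$, regarded as an element of $\mathfrak g^{**}=\mathfrak g$. The Hamiltonian vector field of a smooth function $h$ is $X_h=\Lambda(dh,\cdot)+hE$. For a vector field $X$, let $\phi_t^X$ be the time-$t$ map of its maximal flow, a partially defined map: $\phi^X_t(p)$ is defined if and only if there is an integral curve of $X$ starting at $p$ on an open interval containing $0$ and $t$. Let $H:T^*G\times\mathbb R\to\mathbb R$ be a smooth $G$-invariant function, and let $h=H|_{\mathfrak g^*\times\mathbb R}$ be its restriction to $T_e^*G\times\mathbb R=\mathfrak g^*\times\mathbb R$. Then $h$ is smooth and $$H=h\circ\hat J .$$ Moreover, the vector fields $X_H$ and $X_h$ are $\hat J$-related, that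 is, $T\hat J\circ X_H=X_h\circ\hat J$, and their flows satisfy $$\hat J\circ\phi_t^{X_H}=\phi_t^{X_h}\circ\hat J\qquad\text{for all } t\in\mathbb R,$$ as an equality of partially defined maps (one side is defined at a point if and only if the other one is). -/

import Mathlib

open Bundle Set
open scoped Manifold ContDiff

noncomputable section

/-! ### Contact Hamiltonian vector fields -/

section Contact

variable {E : Type*} [NormedAddCommGroup E] [NormedSpace ℝ E]
  {K : Type*} [TopologicalSpace K] (I : ModelWithCorners ℝ E K)
  {M : Type*} [TopologicalSpace M] [ChartedSpace K M]

/-- The exterior derivative of a 1-form `η` on a manifold. In the chart `φ` around `p`, the form is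
`σ = (φ⁻¹)^* η`, and `dη_p (u, v) = (D σ · u) v - (D σ · v) u` (the derivative being taken at `φ p`,
the vectors `u, v` being read in the chart). -/
def extDerivOneForm (η : (p : M) → TangentSpace I p →L[ℝ] ℝ) (p : M) :
    TangentSpace I p →L[ℝ] TangentSpace I p →L[ℝ] ℝ :=
  let φ := extChartAt I p
  let σ : E → E →L[ℝ] ℝ := fun y =>
    (η (φ.symm y)).comp (mfderivWithin 𝓘(ℝ, E) I φ.symm (range I) y)
  let A : E →L[ℝ] E →L[ℝ] ℝ := fderivWithin ℝ σ (range I) (φ p)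
  let D : E →L[ℝ] E := mfderiv I 𝓘(ℝ, E) φ p
  let B : E →L[ℝ] E →L[ℝ] ℝ := (A - A.flip).bilinearComp D D
  B

/-- The map `♭ : TM → T^*M`, `♭ v = ι_v dη + η(v) η` of a contact form `η`. -/
def contactFlat (η : (p : M) → TangentSpace I p →L[ℝ] ℝ) (p : M) (v : TangentSpace I p) :
    TangentSpace I p →L[ℝ] ℝ :=
  extDerivOneForm I η p v + η p v • η p

/-- The Reeb vector field of a contact form `η`: at each point, the unique vector `r` with
`ι_r dη = 0` and `η(r) = 1`. -/
def reebField (η : (p : M) → TangentSpace I p →L[ℝ] ℝ) (p : M) : TangentSpace I p :=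
  Classical.epsilon fun r : TangentSpace I p => extDerivOneForm I η p r = 0 ∧ η p r = 1

/-- The contact Hamiltonian vector field of `f` for a contact form `η` with Reeb field `R`: at each
point, the unique vector `X_f` with `♭ X_f = df - (f + R f) η`. -/
def contactHamiltonianField (η : (p : M) → TangentSpace I p →L[ℝ] ℝ) (f : M → ℝ) (p : M) :
    TangentSpace I p :=
  let df : TangentSpace I p →L[ℝ] ℝ := mfderiv I 𝓘(ℝ, ℝ) f p
  Classical.epsilon fun X : TangentSpace I p =>
    contactFlat I η p X = df - (f p + df (reebField I η p)) • η p

end Contact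

/-! ### Flows and related vector fields -/

section Flow

variable {E : Type*} [NormedAddCommGroup E] [NormedSpace ℝ E]
  {K : Type*} [TopologicalSpace K] {I : ModelWithCorners ℝ E K}
  {M : Type*} [TopologicalSpace M] [ChartedSpace K M]
  {E' : Type*} [NormedAddCommGroup E'] [NormedSpace ℝ E']
  {K' : Type*} [TopologicalSpace K'] {I' : ModelWithCorners ℝ E' K'}
  {N : Type*} [TopologicalSpace N] [ChartedSpace K' N]

/-- `γ` is an integral curve of `X` starting at `p`, on an open interval containing `0` and `t`. -/
def IsFlowCurve (X : (p : M) → TangentSpace I p) (t : ℝ) (p : M) (γ : ℝ → M) : Prop :=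
  ∃ a b : ℝ, 0 ∈ Ioo a b ∧ t ∈ Ioo a b ∧ γ 0 = p ∧ IsMIntegralCurveOn γ X (Ioo a b)

/-- The time-`t` map `φ_t` of the (maximal) flow of the vector field `X`, as a partially defined
map: `φ_t(p)` is defined iff some integral curve starting at `p` exists up to time `t`, and its
value is then the value at `t` of such a curve (for a smooth field on a Hausdorff manifold without
boundary, it does not depend on the curve). -/
def flow (X : (p : M) → TangentSpace I p) (t : ℝ) (p : M) : Part M where
  Dom := ∃ γ : ℝ → M, IsFlowCurve X t p γ
  get h := Classical.choose h t

/-- The vector fields `X` on `M` and `Y` on `N` are `F`-related: `T F ∘ X = Y ∘ F`. -/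
def FieldsRelated (F : M → N) (X : (p : M) → TangentSpace I p) (Y : (q : N) → TangentSpace I' q) :
    Prop :=
  ∀ p : M, MDifferentiableAt I I' F p ∧ mfderiv I I' F p (X p) = Y (F p)

end Flow

/-! ### The contact manifold `T^*Q × ℝ` -/

section Cotangent

variable (E : Type*) [NormedAddCommGroup E] [NormedSpace ℝ E]
  (Q : Type*) [TopologicalSpace Q] [ChartedSpace E Q] [IsManifold 𝓘(ℝ, E) ∞ Q]

/-- The cotangent bundle `T^*Q`, with the topology and smooth structure of the bundle of
continuous linear maps from `TQ` to the trivial line bundle. Its elements are pairs `⟨q, α⟩` with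
`α ∈ T_q^*Q`. -/
abbrev CotangentBundle : Type _ :=
  TotalSpace (E →L[ℝ] ℝ) (fun q : Q => TangentSpace 𝓘(ℝ, E) q →L[ℝ] ℝ)

/-- The model with corners of `T^*Q`. -/
abbrev cotangentModel : ModelWithCorners ℝ (E × (E →L[ℝ] ℝ)) (ModelProd E (E →L[ℝ] ℝ)) :=
  𝓘(ℝ, E).prod 𝓘(ℝ, E →L[ℝ] ℝ)

/-- The model with corners of `T^*Q × ℝ`. -/
abbrev extCotangentModel : ModelWithCorners ℝ ((E × (E →L[ℝ] ℝ)) × ℝ)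
    (ModelProd (ModelProd E (E →L[ℝ] ℝ)) ℝ) :=
  (cotangentModel E).prod 𝓘(ℝ, ℝ)

variable {Q}

/-- The tautological 1-form `θ` of `T^*Q`: `θ_α (v) = α (T π v)`. -/
def tautologicalForm (α : CotangentBundle E Q) : TangentSpace (cotangentModel E) α →L[ℝ] ℝ :=
  α.2.comp (mfderiv (cotangentModel E) 𝓘(ℝ, E)
    (fun β : CotangentBundle E Q => β.proj) α)

/-- The canonical contact form `η = dz - θ` of `T^*Q × ℝ`. -/
def canonicalContactForm (p : CotangentBundle E Q × ℝ) :
    TangentSpace (extCotangentModel E) p →L[ℝ] ℝ :=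
  let dz : TangentSpace (extCotangentModel E) p →L[ℝ] ℝ :=
    mfderiv (extCotangentModel E) 𝓘(ℝ, ℝ) (fun x : CotangentBundle E Q × ℝ => x.2) p
  dz - (tautologicalForm E p.1).comp (mfderiv (extCotangentModel E) (cotangentModel E)
    (fun x : CotangentBundle E Q × ℝ => x.1) p)

end Cotangent

/-! ### Hamiltonian vector fields of Jacobi structures on a vector space -/

section Jacobi

variable {V : Type*} [NormedAddCommGroup V] [NormedSpace ℝ V]

/-- The vector of a finite dimensional space `V` that corresponds to the element `Φ` of the bidual
`V^{**} = V`: the unique `v` with `β v = Φ β` for all `β ∈ V^*`. -/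
def bidualVector (Φ : (V →L[ℝ] ℝ) → ℝ) : V :=
  Classical.epsilon fun v : V => ∀ β : V →L[ℝ] ℝ, β v = Φ β

/-- For a bivector field `Λ` on `V` and a covector `α` at `x`, the vector `♯_Λ α = Λ(α, ·)`. -/
def jacobiSharp (Λ : V → (V →L[ℝ] ℝ) → (V →L[ℝ] ℝ) → ℝ) (x : V) (α : V →L[ℝ] ℝ) : V :=
  bidualVector (Λ x α)

/-- The Hamiltonian vector field `X_f = ♯_Λ (df) + f R` of `f` for a Jacobi structure `(Λ, R)`
on the vector space `V`. -/
def jacobiHamiltonianField (Λ : V → (V →L[ℝ] ℝ) → (V →L[ℝ] ℝ) → ℝ) (R : V → V) (f : V → ℝ)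
    (x : V) : TangentSpace 𝓘(ℝ, V) x :=
  (jacobiSharp Λ x (fderiv ℝ f x) + f x • R x : V)

end Jacobi

/-! ### Lie groups -/

section LieGroup

variable (E : Type*) [NormedAddCommGroup E] [NormedSpace ℝ E]
  (G : Type*) [TopologicalSpace G] [ChartedSpace E G] [Group G]

/-- The dual `𝔤^*` of the Lie algebra `𝔤 = T_1 G`. The type `GroupLieAlgebra 𝓘(ℝ, E) G` of
elements of `𝔤` unfolds to `E`; the dual is written through `E` in order to carry the norm, hence
the smooth structure, of a finite dimensional vector space. -/
abbrev DualLieAlgebra (_G : Type*) : Type _ := E →L[ℝ] ℝ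

/-- The first component `ξ` of a covector `α = (ξ, a) ∈ (𝔤^* × ℝ)^* = 𝔤 × ℝ`. For `α = df` it is the
functional derivative `δf/δμ`. -/
def lieAlgebraPart (α : DualLieAlgebra E G × ℝ →L[ℝ] ℝ) : GroupLieAlgebra 𝓘(ℝ, E) G :=
  bidualVector (V := E) fun ν : E →L[ℝ] ℝ => α (ν, 0)

/-- The second component `a` of a covector `α = (ξ, a) ∈ (𝔤^* × ℝ)^* = 𝔤 × ℝ`. For `α = df` it is the
partial derivative `∂f/∂z`. -/
def scalarPart (α : DualLieAlgebra E G × ℝ →L[ℝ] ℝ) : ℝ :=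
  α (0, 1)

/-- The bivector field of the Lie-Poisson-Jacobi structure on `𝔤^* × ℝ`:
`Λ(μ, z)(α, β) = ⟨μ, [ξ, ξ']⟩ + ⟨μ, ξ⟩ b - ⟨μ, ξ'⟩ a`, where `α = (ξ, a)` and `β = (ξ', b)`. -/
def liePoissonJacobiBivector (x : DualLieAlgebra E G × ℝ)
    (α β : DualLieAlgebra E G × ℝ →L[ℝ] ℝ) : ℝ :=
  let bracket : GroupLieAlgebra 𝓘(ℝ, E) G := ⁅lieAlgebraPart E G α, lieAlgebraPart E G β⁆
  x.1 bracket
    + x.1 (lieAlgebraPart E G α) * scalarPart E G β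
    - x.1 (lieAlgebraPart E G β) * scalarPart E G α

/-- The vector field `-∂/∂z` of the Lie-Poisson-Jacobi structure on `𝔤^* × ℝ`. -/
def liePoissonJacobiVector (_x : DualLieAlgebra E G × ℝ) : DualLieAlgebra E G × ℝ :=
  (0, -1)

/-- The Hamiltonian vector field of `h` for the Lie-Poisson-Jacobi structure on `𝔤^* × ℝ`. -/
def liePoissonJacobiField (h : DualLieAlgebra E G × ℝ → ℝ) (x : DualLieAlgebra E G × ℝ) :
    TangentSpace 𝓘(ℝ, DualLieAlgebra E G × ℝ) x :=
  jacobiHamiltonianField (liePoissonJacobiBivector E G) (liePoissonJacobiVector E G) h x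

variable {G} [LieGroup 𝓘(ℝ, E) ∞ G]

/-- The cotangent lift of left translations, acting on `T^*G × ℝ`:
`g · (α_k, z) = (α_k ∘ T_{gk} L_{g⁻¹}, z)`, an element of `T_{gk}^*G × ℝ`. -/
def cotangentLiftAction (g : G) (p : CotangentBundle E G × ℝ) : CotangentBundle E G × ℝ :=
  let k : G := p.1.proj
  let L : E →L[ℝ] E := mfderiv 𝓘(ℝ, E) 𝓘(ℝ, E) (fun x : G => g⁻¹ * x) (g * k)
  let α : E →L[ℝ] ℝ := p.1.2
  (⟨g * k, (α.comp L : E →L[ℝ] ℝ)⟩, p.2)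

/-- The momentum map `J : T^*G → 𝔤^*`, `J(α_g) = α_g ∘ T_1 L_g`. -/
def momentumMap (α : CotangentBundle E G) : DualLieAlgebra E G :=
  α.2.comp (mfderiv 𝓘(ℝ, E) 𝓘(ℝ, E) (fun x : G => α.proj * x) 1)

/-- The map `Ĵ(α, z) = (J(α), z)`. -/
def momentumMapHat (p : CotangentBundle E G × ℝ) : DualLieAlgebra E G × ℝ :=
  (momentumMap E p.1, p.2)

/-- The restriction of a function on `T^*G × ℝ` to `𝔤^* × ℝ = T_1^*G × ℝ`. -/
def restrictToIdentity (H : CotangentBundle E G × ℝ → ℝ) (x : DualLieAlgebra E G × ℝ) : ℝ :=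
  H (⟨(1 : G), x.1⟩, x.2)

end LieGroup

end

/-! In cotangent coordinates `((x, ξ), z)` the contact form is `dz - ξ dx`, so the equation defining
the contact field can be solved explicitly: `X_H = (H_ξ, -H_x - H_z ξ, ξ(H_ξ) - H)`. If `F(x)`
denotes the frame of left invariant fields in a chart of `G`, then `Ĵ(x, ξ, z) = (ξ ∘ F(x), z)`.
Acting by the inverse of the base point gives `H = h ∘ Ĵ`, and the chain rule yields, with `δ =
δh/δμ`, `H_ξ = F δ`, `H_x w = ξ(DF(w) δ)` and `H_z = h_z`. In `TĴ X_H` the terms in `DF` combine to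
`ξ(DF(F δ) w - DF(F w) δ)`, which is `⟨μ, [δ, w]⟩` because the bracket of left invariant fields is
left invariant (`leftMulDeriv_mlieBracket`). The result is `X_h`
(`contactHamiltonianField_reduction`).

Relatedness sends integral curves to integral curves, and uniqueness for the smooth field `X_h` on a
vector space identifies the values of the flows; no uniqueness upstairs is needed. For the domains,
an integral curve `c` of `X_h` must be lifted. Its base curve has to solve the reconstruction
equation `k' = T L_k (δ(c))` on `G`. Left translates of solutions are solutions, so local solutions
can be matched at any common time and there is no blow-up (`exists_hasLeftVelocity_of_local`). The
curve given by `(k, c)` in the left trivialization is then an integral curve of `X_H`, because a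
tangent vector is determined by its base component and its image under `TĴ`
(`eq_contactHamiltonianField`).

Computations at a point use the preferred chart there, whose derivative at that point is the
identity of the model space. -/

noncomputable section

/-! ### The exterior derivative of a 1-form in a chart. -/

section ExteriorDerivative

variable {E : Type*} [NormedAddCommGroup E] [NormedSpace ℝ E]
  {K : Type*} [TopologicalSpace K] {I : ModelWithCorners ℝ E K} [I.Boundaryless]
  {M : Type*} [TopologicalSpace M] [ChartedSpace K M] [IsManifold I 1 M]

/-- Stated on the model space alone, so that the substitutions avoid the dependent tangent space
types. -/
lemma sub_flip_bilinearComp_apply {A B : E →L[ℝ] E →L[ℝ] ℝ} {D : E →L[ℝ] E} (hA : A = B)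
    (hD : D = ContinuousLinearMap.id ℝ E) (u v : E) :
    ((A - A.flip).bilinearComp D D) u v = B u v - B v u := by
  subst hA hD; rfl

/-- The exterior derivative at `p` of a 1-form, from its expression in the chart around `p`. -/
lemma extDerivOneForm_eq_of_hasFDerivAt (η : (p : M) → TangentSpace I p →L[ℝ] ℝ) (p : M)
    {σ : E → E →L[ℝ] ℝ} {A : E →L[ℝ] E →L[ℝ] ℝ}
    (hσ : ∀ y ∈ (extChartAt I p).target, (η ((extChartAt I p).symm y)).comp
      (mfderivWithin 𝓘(ℝ, E) I (extChartAt I p).symm (range I) y) = σ y)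
    (hA : HasFDerivAt σ A (extChartAt I p p)) (u v : E) :
    extDerivOneForm I η p u v = A u v - A v u := by
  have hA2 : fderivWithin ℝ (fun y => (η ((extChartAt I p).symm y)).comp
      (mfderivWithin 𝓘(ℝ, E) I (extChartAt I p).symm (range I) y) : E → E →L[ℝ] ℝ)
      (range I) (extChartAt I p p) = A := by
    rw [ModelWithCorners.range_eq_univ, fderivWithin_univ]
    refine (hA.congr_of_eventuallyEq ?_).fderiv
    filter_upwards [extChartAt_target_mem_nhds p] with y hy
    have := hσ y hy
    rw [ModelWithCorners.range_eq_univ] at this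
    exact this
  exact sub_flip_bilinearComp_apply hA2 mfderiv_extChartAt_self u v

end ExteriorDerivative

/-! ### Cotangent coordinates and the canonical contact form. -/

section CotangentCoordinates

variable {E : Type*} [NormedAddCommGroup E] [NormedSpace ℝ E]
  {Q : Type*} [TopologicalSpace Q] [ChartedSpace E Q] [IsManifold 𝓘(ℝ, E) ∞ Q]

/-- The covector of an element of the cotangent bundle, as a linear form on the model space. -/
def covector (q : CotangentBundle E Q) : E →L[ℝ] ℝ := q.2

/-- The derivative at `x`, read from the chart around `q` to the model space, of the inverse of the
chart around `q`. -/
def chartSymmDeriv (q x : Q) : E →L[ℝ] E :=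
  (trivializationAt E (TangentSpace 𝓘(ℝ, E)) q).symmL ℝ x

lemma chartSymmDeriv_eq {q x : Q} (hx : x ∈ (chartAt E q).source) :
    chartSymmDeriv (E := E) q x = mfderivWithin 𝓘(ℝ, E) 𝓘(ℝ, E) (extChartAt 𝓘(ℝ, E) q).symm
      (range 𝓘(ℝ, E)) (extChartAt 𝓘(ℝ, E) q x) :=
  TangentBundle.symmL_trivializationAt hx

lemma chartSymmDeriv_self (q : Q) : chartSymmDeriv (E := E) q q = ContinuousLinearMap.id ℝ E :=
  (chartSymmDeriv_eq (by simp)).trans mfderivWithin_range_extChartAt_symm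

/-- The trivialization of a bundle of linear maps is conjugation by the trivializations of source
and target; the target is the trivial line bundle, so only precomposition remains. -/
lemma extChartAt_cotangentBundle_apply (q x : CotangentBundle E Q) :
    extChartAt (cotangentModel E) q x =
      (extChartAt 𝓘(ℝ, E) q.1 x.1, (covector x).comp (chartSymmDeriv q.1 x.1)) := by
  refine Prod.ext rfl ?_
  change (trivializationAt (E →L[ℝ] ℝ) (fun q : Q => TangentSpace 𝓘(ℝ, E) q →L[ℝ] ℝ) q.1 x).2 = _
  rw [hom_trivializationAt_apply]
  ext v
  simp [ContinuousLinearMap.inCoordinates, covector, chartSymmDeriv]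
  rfl

lemma extChartAt_extCotangent_apply (p x : CotangentBundle E Q × ℝ) :
    extChartAt (extCotangentModel E) p x =
      ((extChartAt 𝓘(ℝ, E) p.1.1 x.1.1, (covector x.1).comp (chartSymmDeriv p.1.1 x.1.1)), x.2) := by
  have h : extChartAt (extCotangentModel E) p x =
      (extChartAt (cotangentModel E) p.1 x.1, x.2) := rfl
  rw [h, extChartAt_cotangentBundle_apply]

lemma extChartAt_extCotangent_self (p : CotangentBundle E Q × ℝ) :
    extChartAt (extCotangentModel E) p p =
      ((extChartAt 𝓘(ℝ, E) p.1.1 p.1.1, covector p.1), p.2) := by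
  rw [extChartAt_extCotangent_apply, chartSymmDeriv_self]
  rfl

lemma mem_chartAt_of_mem_extChartAt_extCotangent_source {p x : CotangentBundle E Q × ℝ}
    (h : x ∈ (extChartAt (extCotangentModel E) p).source) : x.1.1 ∈ (chartAt E p.1.1).source := by
  rw [extChartAt_source] at h
  exact h.1.1.1

lemma hasMFDerivAt_cotangentBundle_proj (q : CotangentBundle E Q) :
    HasMFDerivAt (cotangentModel E) 𝓘(ℝ, E) (fun x : CotangentBundle E Q => x.proj) q
      (ContinuousLinearMap.fst ℝ E (E →L[ℝ] ℝ)) := by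
  refine ⟨(FiberBundle.continuous_proj _ _).continuousAt, ?_⟩
  refine (ContinuousLinearMap.hasFDerivAt _).hasFDerivWithinAt.congr_of_eventuallyEq ?_ ?_
  · filter_upwards [extChartAt_target_mem_nhdsWithin (I := cotangentModel E) q] with y hy
    have := congrArg Prod.fst ((extChartAt (cotangentModel E) q).right_inv hy)
    rw [extChartAt_cotangentBundle_apply] at this
    exact this
  · simp only [writtenInExtChartAt, Function.comp, extChartAt_to_inv]
    rw [extChartAt_cotangentBundle_apply]
    rfl

lemma canonicalContactForm_apply (p : CotangentBundle E Q × ℝ) (v : (E × (E →L[ℝ] ℝ)) × ℝ) :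
    canonicalContactForm E p v = v.2 - covector p.1 v.1.1 := by
  simp only [canonicalContactForm, tautologicalForm]
  rw [(hasMFDerivAt_cotangentBundle_proj p.1).mfderiv, mfderiv_fst, mfderiv_snd]
  rfl

/-- The canonical contact form `dz - θ` in the cotangent coordinates `((x, ξ), z)`. -/
def contactFormCoord (y : (E × (E →L[ℝ] ℝ)) × ℝ) : (E × (E →L[ℝ] ℝ)) × ℝ →L[ℝ] ℝ :=
  ContinuousLinearMap.snd ℝ _ _ -
    y.1.2.comp ((ContinuousLinearMap.fst ℝ _ _).comp (ContinuousLinearMap.fst ℝ _ _))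

/-- The form annihilates fibre directions, so only the base and `z` components of the derivative of
the inverse chart matter. The base component is `chartSymmDeriv`, the very factor that turns the
covector into its coordinate `ξ`; hence `θ = ξ dx` throughout the chart and not only at its centre.
-/
lemma canonicalContactForm_chart (p : CotangentBundle E Q × ℝ) {y : (E × (E →L[ℝ] ℝ)) × ℝ}
    (hy : y ∈ (extChartAt (extCotangentModel E) p).target) :
    (canonicalContactForm E ((extChartAt (extCotangentModel E) p).symm y)).comp
      (mfderivWithin 𝓘(ℝ, (E × (E →L[ℝ] ℝ)) × ℝ) (extCotangentModel E)
        (extChartAt (extCotangentModel E) p).symm (range (extCotangentModel E)) y) =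
      contactFormCoord y := by
  set φ := extChartAt (extCotangentModel E) p with hφ
  set q := φ.symm y with hq
  have hy' : φ q = y := φ.right_inv hy
  have hqs : q.1.1 ∈ (chartAt E p.1.1).source :=
    mem_chartAt_of_mem_extChartAt_extCotangent_source (φ.map_target hy)
  have hcoord := extChartAt_extCotangent_apply p q
  rw [← hφ, hy'] at hcoord
  have hr : range (extCotangentModel E) = univ := ModelWithCorners.range_eq_univ _
  have hd : HasMFDerivWithinAt 𝓘(ℝ, (E × (E →L[ℝ] ℝ)) × ℝ) (extCotangentModel E) φ.symm
      (range (extCotangentModel E)) y _ :=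
    (mdifferentiableWithinAt_extChartAt_symm hy).hasMFDerivWithinAt
  set L := mfderivWithin 𝓘(ℝ, (E × (E →L[ℝ] ℝ)) × ℝ) (extCotangentModel E) φ.symm
      (range (extCotangentModel E)) y with hL
  rw [hr, hasMFDerivWithinAt_univ] at hd
  -- the two components of the derivative of the inverse chart which matter
  have h2 : ∀ v : (E × (E →L[ℝ] ℝ)) × ℝ, (show (E × (E →L[ℝ] ℝ)) × ℝ from L v).2 = v.2 := by
    have h := hasMFDerivAt_snd (I := cotangentModel E) (I' := 𝓘(ℝ, ℝ)) (x := q) |>.comp y hd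
    have h' : HasMFDerivAt 𝓘(ℝ, (E × (E →L[ℝ] ℝ)) × ℝ) 𝓘(ℝ, ℝ) (Prod.snd ∘ φ.symm) y
        (ContinuousLinearMap.snd ℝ (E × (E →L[ℝ] ℝ)) ℝ) := by
      refine (ContinuousLinearMap.hasMFDerivAt _).congr_of_eventuallyEq ?_
      filter_upwards [extChartAt_target_mem_nhds' hy] with w hw
      have := congrArg Prod.snd (φ.right_inv hw)
      rw [extChartAt_extCotangent_apply] at this
      exact this
    intro v
    exact DFunLike.congr_fun (hasMFDerivAt_unique h h') v
  have h1 : ∀ v : (E × (E →L[ℝ] ℝ)) × ℝ, (show (E × (E →L[ℝ] ℝ)) × ℝ from L v).1.1 =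
      chartSymmDeriv p.1.1 q.1.1 v.1.1 := by
    have h := (hasMFDerivAt_cotangentBundle_proj q.1).comp y
      ((hasMFDerivAt_fst (I := cotangentModel E) (I' := 𝓘(ℝ, ℝ)) (x := q)).comp y hd)
    have hx : y.1.1 = extChartAt 𝓘(ℝ, E) p.1.1 q.1.1 := congrArg (fun w => w.1.1) hcoord
    have hyt : y.1.1 ∈ (extChartAt 𝓘(ℝ, E) p.1.1).target := by
      rw [hx]; exact (extChartAt 𝓘(ℝ, E) p.1.1).map_source (by simpa using hqs)
    have hd' : HasMFDerivWithinAt 𝓘(ℝ, E) 𝓘(ℝ, E) (extChartAt 𝓘(ℝ, E) p.1.1).symm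
        (range 𝓘(ℝ, E)) y.1.1 _ :=
      (mdifferentiableWithinAt_extChartAt_symm hyt).hasMFDerivWithinAt
    rw [ModelWithCorners.range_eq_univ, hasMFDerivWithinAt_univ] at hd'
    have h' := (hd'.comp y (ContinuousLinearMap.hasMFDerivAt
      ((ContinuousLinearMap.fst ℝ E (E →L[ℝ] ℝ)).comp
        (ContinuousLinearMap.fst ℝ (E × (E →L[ℝ] ℝ)) ℝ)))).congr_of_eventuallyEq
      (f₁ := (fun x : CotangentBundle E Q => x.proj) ∘ Prod.fst ∘ φ.symm) (by
        filter_upwards [extChartAt_target_mem_nhds' hy] with w hw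
        have hw' := congrArg (fun w => w.1.1) (φ.right_inv hw)
        have hs := mem_chartAt_of_mem_extChartAt_extCotangent_source (φ.map_target hw)
        simp only [hφ, extChartAt_extCotangent_apply] at hw'
        simp only [Function.comp, ContinuousLinearMap.coe_fst', ContinuousLinearMap.coe_comp]
        rw [← hw']
        exact ((extChartAt 𝓘(ℝ, E) p.1.1).left_inv (by simpa using hs)).symm)
    intro v
    rw [chartSymmDeriv_eq hqs, ← hx, ModelWithCorners.range_eq_univ]
    exact DFunLike.congr_fun (hasMFDerivAt_unique h h') v
  have hξ : y.1.2 = (covector q.1).comp (chartSymmDeriv p.1.1 q.1.1) :=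
    congrArg (fun w => w.1.2) hcoord
  refine ContinuousLinearMap.ext fun v => ?_
  refine (canonicalContactForm_apply q (L v)).trans ?_
  refine (congrArg₂ (fun a b => a - covector q.1 b) (h2 v) (h1 v)).trans ?_
  rw [contactFormCoord, hξ]
  rfl

/-- The coordinate expression of the form is affine in the point, so its derivative is its linear
part. -/
lemma hasFDerivAt_sub_comp {V : Type*} [NormedAddCommGroup V] [NormedSpace ℝ V]
    (s : V →L[ℝ] ℝ) (a : V →L[ℝ] E →L[ℝ] ℝ) (b : V →L[ℝ] E) (y : V) :
    HasFDerivAt (fun y => s - (a y).comp b) (-((ContinuousLinearMap.precomp ℝ b).comp a)) y :=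
  (((ContinuousLinearMap.precomp ℝ b).comp a).hasFDerivAt (x := y)).const_sub s

set_option synthInstance.maxHeartbeats 400000 in
lemma exists_hasFDerivAt_contactFormCoord (y : (E × (E →L[ℝ] ℝ)) × ℝ) :
    ∃ A : (E × (E →L[ℝ] ℝ)) × ℝ →L[ℝ] (E × (E →L[ℝ] ℝ)) × ℝ →L[ℝ] ℝ,
      HasFDerivAt contactFormCoord A y ∧ ∀ u v, A u v = -u.1.2 v.1.1 :=
  ⟨_, hasFDerivAt_sub_comp (ContinuousLinearMap.snd ℝ (E × (E →L[ℝ] ℝ)) ℝ)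
    ((ContinuousLinearMap.snd ℝ E (E →L[ℝ] ℝ)).comp (ContinuousLinearMap.fst ℝ _ ℝ))
    ((ContinuousLinearMap.fst ℝ E (E →L[ℝ] ℝ)).comp (ContinuousLinearMap.fst ℝ _ ℝ)) y,
    fun _ _ => rfl⟩

lemma extDerivOneForm_canonicalContactForm (p : CotangentBundle E Q × ℝ)
    (u v : (E × (E →L[ℝ] ℝ)) × ℝ) :
    extDerivOneForm (extCotangentModel E) (canonicalContactForm E) p u v =
      v.1.2 u.1.1 - u.1.2 v.1.1 := by
  obtain ⟨A, hA, hA'⟩ :=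
    exists_hasFDerivAt_contactFormCoord (extChartAt (extCotangentModel E) p p)
  refine (extDerivOneForm_eq_of_hasFDerivAt (canonicalContactForm E) p
    (fun y hy => canonicalContactForm_chart p hy) hA u v).trans ?_
  rw [hA', hA']
  ring

end CotangentCoordinates

/-! ### Reflexivity of finite-dimensional spaces. -/

section Bidual

variable {V : Type*} [NormedAddCommGroup V] [NormedSpace ℝ V] [FiniteDimensional ℝ V]

lemma exists_forall_dual_apply_eq (Φ : (V →L[ℝ] ℝ) →ₗ[ℝ] ℝ) :
    ∃ v : V, ∀ β : V →L[ℝ] ℝ, β v = Φ β := by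
  refine ⟨(Module.evalEquiv ℝ V).symm (Φ ∘ₗ LinearMap.toContinuousLinearMap.toLinearMap), fun β => ?_⟩
  have := Module.apply_evalEquiv_symm_apply ℝ V (β : V →ₗ[ℝ] ℝ)
    (Φ ∘ₗ LinearMap.toContinuousLinearMap.toLinearMap)
  refine this.trans ?_
  exact congrArg Φ (by ext; rfl)

lemma apply_bidualVector (Φ : (V →L[ℝ] ℝ) →ₗ[ℝ] ℝ) (β : V →L[ℝ] ℝ) :
    β (bidualVector Φ) = Φ β :=
  Classical.epsilon_spec (exists_forall_dual_apply_eq Φ) β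

omit [FiniteDimensional ℝ V] in
lemma eq_of_forall_dual_apply_eq {v w : V} (h : ∀ β : V →L[ℝ] ℝ, β v = β w) : v = w :=
  (SeparatingDual.eq_iff_forall_dual_eq (R := ℝ)).2 h

end Bidual

/-! ### The Reeb field and contact Hamiltonian fields in coordinates. -/

section ContactHamiltonian

variable {E : Type*} [NormedAddCommGroup E] [NormedSpace ℝ E] [FiniteDimensional ℝ E]
  {Q : Type*} [TopologicalSpace Q] [ChartedSpace E Q] [IsManifold 𝓘(ℝ, E) ∞ Q]

omit [FiniteDimensional ℝ E] in
lemma reebField_canonicalContactForm (p : CotangentBundle E Q × ℝ) :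
    reebField (extCotangentModel E) (canonicalContactForm E) p =
      (((0, 0), 1) : (E × (E →L[ℝ] ℝ)) × ℝ) := by
  have hex : ∃ r : TangentSpace (extCotangentModel E) p,
      extDerivOneForm (extCotangentModel E) (canonicalContactForm E) p r = 0 ∧
        canonicalContactForm E p r = 1 := by
    refine ⟨(((0, 0), 1) : (E × (E →L[ℝ] ℝ)) × ℝ), ?_, ?_⟩
    · refine ContinuousLinearMap.ext fun v => ?_
      refine (extDerivOneForm_canonicalContactForm p _ v).trans ?_
      simp
    · refine (canonicalContactForm_apply p _).trans ?_
      simp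
  obtain ⟨h1, h2⟩ := Classical.epsilon_spec hex
  change extDerivOneForm (extCotangentModel E) (canonicalContactForm E) p
    (reebField (extCotangentModel E) (canonicalContactForm E) p) = 0 at h1
  change canonicalContactForm E p
    (reebField (extCotangentModel E) (canonicalContactForm E) p) = 1 at h2
  generalize reebField (extCotangentModel E) (canonicalContactForm E) p = r at h1 h2
  obtain ⟨⟨a, b⟩, c⟩ : (E × (E →L[ℝ] ℝ)) × ℝ := r
  -- Uniqueness: pairing with vertical vectors kills the base component, pairing with horizontal
  -- ones kills the fibre component, and the normalization fixes the last one.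
  have h1' (v : (E × (E →L[ℝ] ℝ)) × ℝ) : v.1.2 a - b v.1.1 = 0 :=
    (extDerivOneForm_canonicalContactForm p ((a, b), c) v).symm.trans (DFunLike.congr_fun h1 v)
  have h2' : c - covector p.1 a = 1 :=
    (canonicalContactForm_apply p ((a, b), c)).symm.trans h2
  have ha : a = 0 := eq_of_forall_dual_apply_eq fun β => by simpa using h1' ((0, β), 0)
  have hb : b = 0 := by
    ext w
    simpa using h1' ((w, 0), 0)
  subst ha hb
  have hc : c = 1 := by simpa using h2'
  subst hc
  rfl

/-- The components of the contact Hamiltonian field in cotangent coordinates: with `ξ` the covector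
of `p`, they are `(H_ξ, -H_x - H_z ξ, ξ (H_ξ) - H)`. -/
lemma contactHamiltonianField_canonicalContactForm (f : CotangentBundle E Q × ℝ → ℝ)
    (p : CotangentBundle E Q × ℝ) :
    ∃ (a : E) (b : E →L[ℝ] ℝ) (c : ℝ) (df : (E × (E →L[ℝ] ℝ)) × ℝ →L[ℝ] ℝ),
      contactHamiltonianField (extCotangentModel E) (canonicalContactForm E) f p =
        (((a, b), c) : (E × (E →L[ℝ] ℝ)) × ℝ) ∧
      df = mfderiv (extCotangentModel E) 𝓘(ℝ, ℝ) f p ∧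
      (∀ β, β a = df ((0, β), 0)) ∧
      (∀ w, b w = -df ((w, 0), 0) - df ((0, 0), 1) * covector p.1 w) ∧
      c = covector p.1 a - f p := by
  let df : (E × (E →L[ℝ] ℝ)) × ℝ →L[ℝ] ℝ := mfderiv (extCotangentModel E) 𝓘(ℝ, ℝ) f p
  have hdf : ∀ v : (E × (E →L[ℝ] ℝ)) × ℝ,
      df v = df ((v.1.1, 0), 0) + df ((0, v.1.2), 0) + v.2 * df ((0, 0), 1) := by
    intro v
    have hv : v = ((v.1.1, 0), 0) + ((0, v.1.2), 0) + v.2 • ((0, 0), 1) := by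
      ext <;> simp
    conv_lhs => rw [hv]
    rw [map_add, map_add, map_smul, smul_eq_mul]
  -- the defining equation of the field, in coordinates
  have key : ∀ X : (E × (E →L[ℝ] ℝ)) × ℝ,
      (contactFlat (extCotangentModel E) (canonicalContactForm E) p X =
        (show TangentSpace (extCotangentModel E) p →L[ℝ] ℝ from df) -
          (f p + (show TangentSpace (extCotangentModel E) p →L[ℝ] ℝ from df)
            (reebField (extCotangentModel E) (canonicalContactForm E) p)) •
            canonicalContactForm E p) ↔
      ∀ v : (E × (E →L[ℝ] ℝ)) × ℝ,
        v.1.2 X.1.1 - X.1.2 v.1.1 + (X.2 - covector p.1 X.1.1) * (v.2 - covector p.1 v.1.1) =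
        df v - (f p + df ((0, 0), 1)) * (v.2 - covector p.1 v.1.1) := by
    intro X
    rw [reebField_canonicalContactForm]
    have hl : ∀ v : (E × (E →L[ℝ] ℝ)) × ℝ,
        contactFlat (extCotangentModel E) (canonicalContactForm E) p X v =
        v.1.2 X.1.1 - X.1.2 v.1.1 + (X.2 - covector p.1 X.1.1) * (v.2 - covector p.1 v.1.1) := by
      intro v
      exact congrArg₂ (· + ·) (extDerivOneForm_canonicalContactForm p X v)
        (congrArg₂ (· * ·) (canonicalContactForm_apply p X) (canonicalContactForm_apply p v))
    have hr : ∀ v : (E × (E →L[ℝ] ℝ)) × ℝ,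
        ((show TangentSpace (extCotangentModel E) p →L[ℝ] ℝ from df) -
          (f p + (show TangentSpace (extCotangentModel E) p →L[ℝ] ℝ from df)
            (((0, 0), 1) : (E × (E →L[ℝ] ℝ)) × ℝ)) •
            canonicalContactForm E p) v =
        df v - (f p + df ((0, 0), 1)) * (v.2 - covector p.1 v.1.1) := by
      intro v
      exact congrArg (fun t => df v - (f p + df ((0, 0), 1)) * t) (canonicalContactForm_apply p v)
    constructor
    · intro h v
      rw [← hl, ← hr]
      exact DFunLike.congr_fun h v
    · intro h
      refine ContinuousLinearMap.ext fun v => ?_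
      exact (hl v).trans ((h v).trans (hr v).symm)
  have hex : ∃ X : (E × (E →L[ℝ] ℝ)) × ℝ,
      contactFlat (extCotangentModel E) (canonicalContactForm E) p X =
        (show TangentSpace (extCotangentModel E) p →L[ℝ] ℝ from df) -
          (f p + (show TangentSpace (extCotangentModel E) p →L[ℝ] ℝ from df)
            (reebField (extCotangentModel E) (canonicalContactForm E) p)) •
            canonicalContactForm E p := by
    -- The fibre derivative of `f` lies in the bidual of `E`; reflexivity turns it into the base
    -- component of the field.
    obtain ⟨a, ha⟩ := exists_forall_dual_apply_eq
      (V := E) ((df : (E × (E →L[ℝ] ℝ)) × ℝ →ₗ[ℝ] ℝ) ∘ₗ LinearMap.inl ℝ _ _ ∘ₗ LinearMap.inr ℝ _ _)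
    have ha' : ∀ β, β a = df ((0, β), 0) := ha
    refine ⟨((a, -(df.comp ((ContinuousLinearMap.inl ℝ _ _).comp (ContinuousLinearMap.inl ℝ _ _))) -
      df ((0, 0), 1) • covector p.1), covector p.1 a - f p), (key _).2 fun v => ?_⟩
    rw [hdf v, ← ha']
    simp
    ring
  have hX₀ : contactFlat (extCotangentModel E) (canonicalContactForm E) p
      (contactHamiltonianField (extCotangentModel E) (canonicalContactForm E) f p) = _ :=
    Classical.epsilon_spec hex
  obtain ⟨X, hXeq⟩ : ∃ X : (E × (E →L[ℝ] ℝ)) × ℝ,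
      contactHamiltonianField (extCotangentModel E) (canonicalContactForm E) f p = X := ⟨_, rfl⟩
  rw [hXeq] at hX₀
  have hX := (key X).1 hX₀
  refine ⟨X.1.1, X.1.2, X.2, df, hXeq, rfl, ?_⟩
  -- Testing on `∂/∂z` gives `η(X) = -f`; with this value known, vertical and horizontal test
  -- vectors isolate the other two components.
  have hc := hX ((0, 0), 1)
  simp only [zero_apply, map_zero, sub_zero, mul_one, zero_add] at hc
  refine ⟨fun β => ?_, fun w => ?_, ?_⟩
  · simpa using hX ((0, β), 0)
  · have hw := hX ((w, 0), 0)
    simp only [zero_apply, hc, zero_sub] at hw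
    linear_combination -hw
  · linear_combination hc

end ContactHamiltonian

/-! ### Left translations and the left invariant frame in a chart. -/

section LeftTranslations

variable {E : Type*} [NormedAddCommGroup E] [NormedSpace ℝ E]
  {G : Type*} [TopologicalSpace G] [ChartedSpace E G] [Group G]

/-- The derivative at `k` of the left translation by `g`, as a linear map of the model space. -/
def leftMulDeriv (g k : G) : E →L[ℝ] E :=
  mfderiv 𝓘(ℝ, E) 𝓘(ℝ, E) (fun x : G => g * x) k

/-- The derivative at `k` of the chart around `g`, as a linear map of the model space. -/
def chartDeriv (g k : G) : E →L[ℝ] E :=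
  mfderiv 𝓘(ℝ, E) 𝓘(ℝ, E) (extChartAt 𝓘(ℝ, E) g) k

/-- The frame of left invariant vector fields in the chart around `g`: it maps `v` to the left
invariant field defined by `v`, at the point of coordinate `x`. -/
def leftFrame (g : G) (x : E) : E →L[ℝ] E :=
  (chartDeriv g ((extChartAt 𝓘(ℝ, E) g).symm x)).comp
    (leftMulDeriv ((extChartAt 𝓘(ℝ, E) g).symm x) 1)

lemma leftMulDeriv_one_left (k : G) : leftMulDeriv 1 k = ContinuousLinearMap.id ℝ E := by
  have h1 : (fun x : G => 1 * x) = id := by ext x; simp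
  rw [leftMulDeriv, h1]
  exact mfderiv_id

lemma leftFrame_extChartAt {g k : G} (hk : k ∈ (chartAt E g).source) :
    leftFrame g (extChartAt 𝓘(ℝ, E) g k) = (chartDeriv g k).comp (leftMulDeriv k 1) := by
  rw [leftFrame, (extChartAt 𝓘(ℝ, E) g).left_inv (by simpa using hk)]

variable [LieGroup 𝓘(ℝ, E) ∞ G]

lemma lieGroup_minSmoothness : LieGroup 𝓘(ℝ, E) (minSmoothness ℝ 3) G :=
  LieGroup.of_le (n := ∞) (by
    rw [minSmoothness_of_isRCLikeNormedField]; exact ENat.LEInfty.out)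

lemma leftMulDeriv_mul (g h k : G) :
    leftMulDeriv (E := E) (g * h) k = (leftMulDeriv g (h * k)).comp (leftMulDeriv h k) := by
  have h1 : (fun x : G => g * h * x) = (fun x => g * x) ∘ (fun x => h * x) := by
    ext x; simp [mul_assoc]
  rw [leftMulDeriv, h1, mfderiv_comp k 
    ((contMDiff_mul_left (I := 𝓘(ℝ, E)) (n := ∞)).mdifferentiable (by simp) _)
    ((contMDiff_mul_left (I := 𝓘(ℝ, E)) (n := ∞)).mdifferentiable (by simp) k)]
  rfl

lemma leftMulDeriv_inv_comp (k : G) :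
    (leftMulDeriv k⁻¹ k).comp (leftMulDeriv k 1) = ContinuousLinearMap.id ℝ E := by
  have := leftMulDeriv_mul (E := E) k⁻¹ k 1
  rwa [inv_mul_cancel, leftMulDeriv_one_left, mul_one, eq_comm] at this

lemma leftMulDeriv_comp_inv (k : G) :
    (leftMulDeriv k 1).comp (leftMulDeriv k⁻¹ k) = ContinuousLinearMap.id ℝ E := by
  have := leftMulDeriv_mul (E := E) k k⁻¹ k
  rwa [mul_inv_cancel, leftMulDeriv_one_left, inv_mul_cancel, eq_comm] at this

lemma chartDeriv_self (g : G) : chartDeriv g g = ContinuousLinearMap.id ℝ E :=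
  mfderiv_extChartAt_self

lemma leftFrame_extChartAt_self (g : G) :
    leftFrame g (extChartAt 𝓘(ℝ, E) g g) = leftMulDeriv g 1 := by
  rw [leftFrame_extChartAt (by simp), chartDeriv_self, ContinuousLinearMap.id_comp]

lemma chartSymmDeriv_comp_chartDeriv {g k : G} (hk : k ∈ (chartAt E g).source) :
    (chartSymmDeriv g k).comp (chartDeriv g k) = ContinuousLinearMap.id ℝ E := by
  rw [chartSymmDeriv_eq hk]
  exact mfderivWithin_extChartAt_symm_comp_mfderiv_extChartAt' (by simpa using hk)

lemma chartDeriv_comp_chartSymmDeriv {g k : G} (hk : k ∈ (chartAt E g).source) :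
    (chartDeriv g k).comp (chartSymmDeriv g k) = ContinuousLinearMap.id ℝ E := by
  rw [chartSymmDeriv_eq hk]
  exact mfderiv_extChartAt_comp_mfderivWithin_extChartAt_symm' (by simpa using hk)

lemma chartSymmDeriv_comp_leftFrame {g k : G} (hk : k ∈ (chartAt E g).source) :
    (chartSymmDeriv g k).comp (leftFrame g (extChartAt 𝓘(ℝ, E) g k)) = leftMulDeriv k 1 := by
  rw [leftFrame_extChartAt hk, ← ContinuousLinearMap.comp_assoc, chartSymmDeriv_comp_chartDeriv hk,
    ContinuousLinearMap.id_comp]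

variable [FiniteDimensional ℝ E]

/-- Left invariant vector fields are smooth sections of the tangent bundle, and in finite dimension
a family of operators is as regular as its values on each fixed vector. Class `C^2` suffices for the
later uses. -/
lemma contDiffOn_leftFrame (g : G) :
    ContDiffOn ℝ 2 (leftFrame g) (extChartAt 𝓘(ℝ, E) g).target := by
  have : LieGroup 𝓘(ℝ, E) (minSmoothness ℝ 3) G := lieGroup_minSmoothness
  refine contDiffOn_clm_apply.2 fun v => ?_
  rw [← contMDiffOn_iff_contDiffOn]
  have hs := contMDiff_mulInvariantVectorField (I := 𝓘(ℝ, E)) (G := G) v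
  simp only [minSmoothness_of_isRCLikeNormedField] at hs
  have h1 := ((trivializationAt E (TangentSpace 𝓘(ℝ, E)) g).contMDiffOn_section_baseSet_iff
    (IB := 𝓘(ℝ, E))).1 hs.contMDiffOn
  have h2 := h1.comp ((contMDiffOn_extChartAt_symm (I := 𝓘(ℝ, E)) (n := ∞) g).of_le
    (ENat.LEInfty.out)) (fun x hx => by
      have := (extChartAt 𝓘(ℝ, E) g).map_target hx
      simpa using this)
  refine h2.congr fun x hx => ?_
  have hx' : (extChartAt 𝓘(ℝ, E) g).symm x ∈ (chartAt E g).source := by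
    simpa using (extChartAt 𝓘(ℝ, E) g).map_target hx
  have h3 := TangentBundle.continuousLinearMapAt_trivializationAt (I := 𝓘(ℝ, E)) hx'
  have h4 := DFunLike.congr_fun h3 (mulInvariantVectorField (I := 𝓘(ℝ, E)) (G := G) v
    ((extChartAt 𝓘(ℝ, E) g).symm x))
  refine h4.symm.trans ?_
  rw [Trivialization.continuousLinearMapAt_apply, Trivialization.coe_linearMapAt_of_mem]
  · rfl
  · exact hx'

/-- The bracket of the Lie algebra, translated to `g` and read in the chart around `g`. -/
lemma leftMulDeriv_mlieBracket (g : G) (v w : E) :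
    leftMulDeriv (E := E) g 1 (VectorField.mlieBracket (E := E) (M := G) 𝓘(ℝ, E)
      (mulInvariantVectorField (I := 𝓘(ℝ, E)) (G := G) v)
      (mulInvariantVectorField (I := 𝓘(ℝ, E)) (G := G) w) 1 : E) =
    fderiv ℝ (leftFrame g) (extChartAt 𝓘(ℝ, E) g g) (leftMulDeriv g 1 v) w -
      fderiv ℝ (leftFrame g) (extChartAt 𝓘(ℝ, E) g g) (leftMulDeriv g 1 w) v := by
  have : LieGroup 𝓘(ℝ, E) (minSmoothness ℝ 3) G := lieGroup_minSmoothness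
  -- The bracket is itself left invariant, so the translate of its value at `1` is its value at `g`,
  -- which can be computed in the chart around `g`.
  have h := congrFun (mulInvariantVector_mlieBracket (I := 𝓘(ℝ, E)) (G := G) v w) g
  refine h.trans ?_
  have hV : ∀ v : E, ∀ x ∈ (extChartAt 𝓘(ℝ, E) g).target,
      VectorField.mpullbackWithin 𝓘(ℝ, E) 𝓘(ℝ, E) (extChartAt 𝓘(ℝ, E) g).symm
        (mulInvariantVectorField (I := 𝓘(ℝ, E)) (G := G) v) (range 𝓘(ℝ, E)) x =
        leftFrame g x v := by
    intro v x hx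
    rw [VectorField.mpullbackWithin_apply]
    have h := ContinuousLinearMap.inverse_eq
      (mfderivWithin_extChartAt_symm_comp_mfderiv_extChartAt (I := 𝓘(ℝ, E)) hx)
      (mfderiv_extChartAt_comp_mfderivWithin_extChartAt_symm (I := 𝓘(ℝ, E)) hx)
    rw [h]
    rfl
  have hbr : ∀ V W : E → E, V =ᶠ[nhds (extChartAt 𝓘(ℝ, E) g g)] (fun x => leftFrame g x v) →
      W =ᶠ[nhds (extChartAt 𝓘(ℝ, E) g g)] (fun x => leftFrame g x w) →
      VectorField.lieBracketWithin ℝ V W ((extChartAt 𝓘(ℝ, E) g).symm ⁻¹' univ ∩ range 𝓘(ℝ, E))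
        (extChartAt 𝓘(ℝ, E) g g) =
      fderiv ℝ (leftFrame g) (extChartAt 𝓘(ℝ, E) g g) (leftMulDeriv g 1 v) w -
      fderiv ℝ (leftFrame g) (extChartAt 𝓘(ℝ, E) g g) (leftMulDeriv g 1 w) v := by
    intro V W hV hW
    rw [preimage_univ, univ_inter, ModelWithCorners.range_eq_univ,
      VectorField.lieBracketWithin_univ, hV.lieBracket_vectorField_eq hW, VectorField.lieBracket]
    have hd : DifferentiableAt ℝ (leftFrame g) (extChartAt 𝓘(ℝ, E) g g) :=
      ((contDiffOn_leftFrame g).contDiffAt (extChartAt_target_mem_nhds g)).differentiableAt (by simp)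
    have hf : ∀ u : E, HasFDerivAt (fun x => leftFrame g x u)
        ((fderiv ℝ (leftFrame g) (extChartAt 𝓘(ℝ, E) g g)).flip u) (extChartAt 𝓘(ℝ, E) g g) := by
      intro u
      have := hd.hasFDerivAt.clm_apply (hasFDerivAt_const u _)
      simpa using this
    rw [(hf v).fderiv, (hf w).fderiv, leftFrame_extChartAt_self]
    rfl
  have hnhds := extChartAt_target_mem_nhds (I := 𝓘(ℝ, E)) g
  have hb := hbr _ _ (Filter.eventuallyEq_of_mem hnhds (hV v))
    (Filter.eventuallyEq_of_mem hnhds (hV w))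
  -- The manifold bracket is pulled back from the chart, and this pullback is trivial at the centre.
  have hinv : (mfderiv 𝓘(ℝ, E) 𝓘(ℝ, E) (extChartAt 𝓘(ℝ, E) g) g).inverse =
      ContinuousLinearMap.id ℝ E := by
    rw [mfderiv_extChartAt_self]
    exact ContinuousLinearMap.inverse_id
  refine (DFunLike.congr_fun hinv _).trans hb

end LeftTranslations

/-! ### The bidual isomorphism as a continuous linear map. -/

section Bidual

variable {V : Type*} [NormedAddCommGroup V] [NormedSpace ℝ V] [FiniteDimensional ℝ V]

lemma apply_bidualVector_clm (Φ : (V →L[ℝ] ℝ) →L[ℝ] ℝ) (β : V →L[ℝ] ℝ) :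
    β (bidualVector Φ) = Φ β :=
  apply_bidualVector (Φ : (V →L[ℝ] ℝ) →ₗ[ℝ] ℝ) β

set_option synthInstance.maxHeartbeats 400000 in
/-- The isomorphism `V^{**} = V`, as a continuous linear map. -/
def bidualVectorL (V : Type*) [NormedAddCommGroup V] [NormedSpace ℝ V] [FiniteDimensional ℝ V] :
    ((V →L[ℝ] ℝ) →L[ℝ] ℝ) →L[ℝ] V :=
  LinearMap.toContinuousLinearMap
    { toFun := fun Φ : (V →L[ℝ] ℝ) →L[ℝ] ℝ => bidualVector Φ
      map_add' := fun Φ Ψ => eq_of_forall_dual_apply_eq fun β : V →L[ℝ] ℝ => by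
        rw [map_add, apply_bidualVector_clm, apply_bidualVector_clm, apply_bidualVector_clm]
        rfl
      map_smul' := fun c Φ => eq_of_forall_dual_apply_eq fun β : V →L[ℝ] ℝ => by
        rw [map_smul, apply_bidualVector_clm, apply_bidualVector_clm]
        rfl }

omit [FiniteDimensional ℝ V] in
-- A known representing vector makes any proof of linearity of `Φ` unnecessary; this is how
-- `jacobiSharp` is computed.
lemma bidualVector_eq_of_forall {Φ : (V →L[ℝ] ℝ) → ℝ} {v : V} (hv : ∀ β, β v = Φ β) :
    bidualVector Φ = v :=
  eq_of_forall_dual_apply_eq fun β =>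
    (Classical.epsilon_spec (p := fun v : V => ∀ β, β v = Φ β) ⟨v, hv⟩ β).trans (hv β).symm

end Bidual

/-! ### The reduced Hamiltonian field on `𝔤^* × ℝ`. -/

section LiePoissonJacobi

variable {E : Type*} [NormedAddCommGroup E] [NormedSpace ℝ E] [FiniteDimensional ℝ E]
  {G : Type*} [TopologicalSpace G] [ChartedSpace E G] [Group G]

lemma apply_lieAlgebraPart (α : DualLieAlgebra E G × ℝ →L[ℝ] ℝ) (ν : E →L[ℝ] ℝ) :
    ν (lieAlgebraPart E G α) = α (ν, 0) :=
  apply_bidualVector (V := E)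
    ((α : DualLieAlgebra E G × ℝ →ₗ[ℝ] ℝ) ∘ₗ LinearMap.inl ℝ (E →L[ℝ] ℝ) ℝ) ν

/-- Splitting a test covector `β` into its `𝔤` and scalar parts shows that `Λ(dh, β)` is the pairing
of `β` with `(b, ⟨μ, δh/δμ⟩)`; the field `hE` then contributes `-h` to the last component. -/
lemma liePoissonJacobiField_eq (h : DualLieAlgebra E G × ℝ → ℝ) (x : DualLieAlgebra E G × ℝ)
    (b : E →L[ℝ] ℝ)
    (hb : ∀ w : E, b w =
      x.1 (VectorField.mlieBracket (E := E) (M := G) 𝓘(ℝ, E)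
        (mulInvariantVectorField (I := 𝓘(ℝ, E)) (G := G) (lieAlgebraPart E G (fderiv ℝ h x)))
        (mulInvariantVectorField (I := 𝓘(ℝ, E)) (G := G) w) 1 : E) -
      fderiv ℝ h x (0, 1) * x.1 w) :
    liePoissonJacobiField E G h x = (b, x.1 (lieAlgebraPart E G (fderiv ℝ h x)) - h x) := by
  have hS : jacobiSharp (liePoissonJacobiBivector E G) x (fderiv ℝ h x) =
      (b, x.1 (lieAlgebraPart E G (fderiv ℝ h x))) := by
    refine bidualVector_eq_of_forall fun β => ?_
    have hβ : β (b, x.1 (lieAlgebraPart E G (fderiv ℝ h x))) =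
        β (b, 0) + x.1 (lieAlgebraPart E G (fderiv ℝ h x)) * β (0, 1) := by
      rw [← smul_eq_mul, ← map_smul, ← map_add]
      simp
    rw [hβ, ← apply_lieAlgebraPart, liePoissonJacobiBivector, scalarPart, scalarPart]
    have := hb (lieAlgebraPart E G β)
    refine (congrArg (· + _) this).trans ?_
    rw [sub_add_eq_add_sub, mul_comm (fderiv ℝ h x (0, 1))]
    rfl
  rw [liePoissonJacobiField, jacobiHamiltonianField, hS, liePoissonJacobiVector]
  simp only [Prod.smul_mk, smul_zero, smul_eq_mul, mul_neg, mul_one, Prod.mk_add_mk, add_zero,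
    sub_eq_add_neg]
  rfl

end LiePoissonJacobi

/-! ### The momentum map, its derivative, and `H = h ∘ Ĵ`. -/

section MomentumMap

lemma hasFDerivAt_clm_comp_prodMk {E V W : Type*} [NormedAddCommGroup E]
    [NormedSpace ℝ E] [NormedAddCommGroup V] [NormedSpace ℝ V]
    [NormedAddCommGroup W] [NormedSpace ℝ W] {A : W → E →L[ℝ] E} {A' : W →L[ℝ] E →L[ℝ] E}
    (a : V →L[ℝ] E →L[ℝ] ℝ) (b : V →L[ℝ] W) (s : V →L[ℝ] ℝ) (y : V) (hA : HasFDerivAt A A' (b y)) :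
    ∃ T : V →L[ℝ] (E →L[ℝ] ℝ) × ℝ,
      HasFDerivAt (fun y => ((a y).comp (A (b y)), s y)) T y ∧
        ∀ u, T u = ((a u).comp (A (b y)) + (a y).comp (A' (b u)), s u) := by
  refine ⟨_, (a.hasFDerivAt.clm_comp (hA.comp y b.hasFDerivAt)).prodMk s.hasFDerivAt, fun u => ?_⟩
  simp [add_comm]

variable {E : Type*} [NormedAddCommGroup E] [NormedSpace ℝ E]
  {G : Type*} [TopologicalSpace G] [ChartedSpace E G] [Group G] [LieGroup 𝓘(ℝ, E) ∞ G]

omit [LieGroup 𝓘(ℝ, E) ∞ G] in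
lemma momentumMapHat_apply (p : CotangentBundle E G × ℝ) :
    momentumMapHat E p = ((covector p.1).comp (leftMulDeriv p.1.proj 1), p.2) := rfl

omit [LieGroup 𝓘(ℝ, E) ∞ G] in
lemma eq_restrictToIdentity_comp_momentumMapHat {H : CotangentBundle E G × ℝ → ℝ}
    (hinv : ∀ (g : G) (p : CotangentBundle E G × ℝ), H (cotangentLiftAction E g p) = H p) :
    H = restrictToIdentity E H ∘ momentumMapHat E := by
  funext p
  -- After acting by the inverse of the base point, the new base point equals `1` only
  -- propositionally while the fibre depends on it; generalizing both group elements allows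
  -- substitution.
  have key : ∀ k k' : G, k = p.1.proj → k' = 1 →
      ((⟨k', ((covector p.1).comp (leftMulDeriv k k') : E →L[ℝ] ℝ)⟩, p.2) :
        CotangentBundle E G × ℝ) =
      (⟨1, ((covector p.1).comp (leftMulDeriv p.1.proj 1) : E →L[ℝ] ℝ)⟩, p.2) := by
    rintro k k' rfl rfl; rfl
  rw [← hinv p.1.proj⁻¹ p]
  exact congrArg H (key _ _ (inv_inv _) (inv_mul_cancel _))

lemma contMDiff_fiberInclusion (g : G) :
    ContMDiff 𝓘(ℝ, DualLieAlgebra E G × ℝ) (extCotangentModel E) ∞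
      (fun x : DualLieAlgebra E G × ℝ => ((⟨g, x.1⟩, x.2) : CotangentBundle E G × ℝ)) := by
  intro x
  refine ContMDiffAt.prodMk ?_ contDiff_snd.contMDiff.contMDiffAt
  rw [contMDiffAt_totalSpace]
  refine ⟨contMDiffAt_const, ?_⟩
  have : ContMDiff 𝓘(ℝ, DualLieAlgebra E G × ℝ) 𝓘(ℝ, E →L[ℝ] ℝ) ∞
    (fun x : DualLieAlgebra E G × ℝ => x.1.comp (chartSymmDeriv g g)) := by
    rw [contMDiff_iff_contDiff]
    fun_prop
  refine this.contMDiffAt.congr_of_eventuallyEq (Filter.Eventually.of_forall fun y => ?_)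
  exact congrArg Prod.snd (extChartAt_cotangentBundle_apply (⟨g, x.1⟩ : CotangentBundle E G) ⟨g, y.1⟩)

lemma contDiff_restrictToIdentity {H : CotangentBundle E G × ℝ → ℝ}
    (hH : ContMDiff (extCotangentModel E) 𝓘(ℝ, ℝ) ∞ H) :
    ContDiff ℝ ∞ (restrictToIdentity E H) :=
  contMDiff_iff_contDiff.1 (hH.comp (contMDiff_fiberInclusion 1))

variable [FiniteDimensional ℝ E]

/-- The derivative of `Ĵ` in cotangent coordinates. -/
lemma exists_hasMFDerivAt_momentumMapHat (p : CotangentBundle E G × ℝ) :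
    ∃ T : (E × (E →L[ℝ] ℝ)) × ℝ →L[ℝ] DualLieAlgebra E G × ℝ,
      HasMFDerivAt (extCotangentModel E) 𝓘(ℝ, DualLieAlgebra E G × ℝ) (momentumMapHat E) p T ∧
      ∀ u, T u = (u.1.2.comp (leftMulDeriv p.1.proj 1) + (covector p.1).comp
        (fderiv ℝ (leftFrame p.1.proj) (extChartAt 𝓘(ℝ, E) p.1.proj p.1.proj) u.1.1), u.2) := by
  have hd : DifferentiableAt ℝ (leftFrame p.1.proj) (extChartAt 𝓘(ℝ, E) p.1.proj p.1.proj) :=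
    ((contDiffOn_leftFrame p.1.proj).contDiffAt
      (extChartAt_target_mem_nhds p.1.proj)).differentiableAt (by simp)
  have hself := extChartAt_extCotangent_self p
  obtain ⟨T, hT, hT'⟩ := hasFDerivAt_clm_comp_prodMk
    ((ContinuousLinearMap.snd ℝ E (E →L[ℝ] ℝ)).comp (ContinuousLinearMap.fst ℝ _ ℝ))
    ((ContinuousLinearMap.fst ℝ E (E →L[ℝ] ℝ)).comp (ContinuousLinearMap.fst ℝ _ ℝ))
    (ContinuousLinearMap.snd ℝ (E × (E →L[ℝ] ℝ)) ℝ) (extChartAt (extCotangentModel E) p p)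
    (A := leftFrame p.1.proj) (by rw [hself]; exact hd.hasFDerivAt)
  refine ⟨T, ?_, fun u => ?_⟩
  · have h1 := (mdifferentiableAt_extChartAt (I := extCotangentModel E)
      (mem_chart_source _ p)).hasMFDerivAt
    rw [mfderiv_extChartAt_self] at h1
    have h2 := (hT.hasMFDerivAt).comp p h1
    -- Near `p` the map `Ĵ` factors through the chart as `(ξ ∘ F(x), z)`, since `chartSymmDeriv`
    -- composed with the frame is the derivative of left translation.
    refine HasMFDerivAt.congr_of_eventuallyEq (f₁ := momentumMapHat E) h2 ?_
    filter_upwards [extChartAt_source_mem_nhds (I := extCotangentModel E) p] with q hq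
    have hq' := mem_chartAt_of_mem_extChartAt_extCotangent_source hq
    simp only [Function.comp, extChartAt_extCotangent_apply]
    rw [momentumMapHat_apply, ← chartSymmDeriv_comp_leftFrame hq', ← ContinuousLinearMap.comp_assoc]
    rfl
  · rw [hT', hself]
    rw [← leftFrame_extChartAt_self]
    rfl

end MomentumMap

/-! ### The functional derivative and its smoothness. -/

section FunctionalDerivative

variable {E : Type*} [NormedAddCommGroup E] [NormedSpace ℝ E]

/-- The functional derivative `δh/δμ`, as a vector of the model space. -/
def functionalDeriv (h : (E →L[ℝ] ℝ) × ℝ → ℝ) (x : (E →L[ℝ] ℝ) × ℝ) : E :=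
  bidualVector fun ν : E →L[ℝ] ℝ => fderiv ℝ h x (ν, 0)

variable [FiniteDimensional ℝ E]

lemma apply_functionalDeriv (h : (E →L[ℝ] ℝ) × ℝ → ℝ) (x : (E →L[ℝ] ℝ) × ℝ) (ν : E →L[ℝ] ℝ) :
    ν (functionalDeriv h x) = fderiv ℝ h x (ν, 0) :=
  apply_bidualVector_clm ((fderiv ℝ h x).comp (ContinuousLinearMap.inl ℝ (E →L[ℝ] ℝ) ℝ)) ν

set_option synthInstance.maxHeartbeats 400000 in
lemma contDiff_functionalDeriv {h : (E →L[ℝ] ℝ) × ℝ → ℝ} (hh : ContDiff ℝ ∞ h) :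
    ContDiff ℝ ∞ (functionalDeriv h) := by
  have h1 : ContDiff ℝ ∞ (fderiv ℝ h) := hh.fderiv_right (m := ∞) (by simp)
  have h2 : ContDiff ℝ ∞ (fun x => (fderiv ℝ h x).comp
    (ContinuousLinearMap.inl ℝ (E →L[ℝ] ℝ) ℝ)) := h1.clm_comp contDiff_const
  exact (bidualVectorL E).contDiff.comp h2

end FunctionalDerivative

/-! ### `TĴ` maps `X_H` to `X_h`. -/

section Reduction

variable {E : Type*} [NormedAddCommGroup E] [NormedSpace ℝ E] [FiniteDimensional ℝ E]
  {G : Type*} [TopologicalSpace G] [ChartedSpace E G] [Group G] [LieGroup 𝓘(ℝ, E) ∞ G]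

/-- The base component of `X_H` is the left translation of the functional derivative of `h`, and
`T Ĵ` maps `X_H` to `X_h`. -/
lemma contactHamiltonianField_reduction {H : CotangentBundle E G × ℝ → ℝ}
    {h : DualLieAlgebra E G × ℝ → ℝ} (hHh : H = h ∘ momentumMapHat E)
    (p : CotangentBundle E G × ℝ) (hh : DifferentiableAt ℝ h (momentumMapHat E p))
    {T : (E × (E →L[ℝ] ℝ)) × ℝ →L[ℝ] DualLieAlgebra E G × ℝ}
    (hT : HasMFDerivAt (extCotangentModel E) 𝓘(ℝ, DualLieAlgebra E G × ℝ) (momentumMapHat E) p T)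
    (hT' : ∀ u, T u = (u.1.2.comp (leftMulDeriv p.1.proj 1) + (covector p.1).comp
        (fderiv ℝ (leftFrame p.1.proj) (extChartAt 𝓘(ℝ, E) p.1.proj p.1.proj) u.1.1), u.2)) :
    ∃ X : (E × (E →L[ℝ] ℝ)) × ℝ,
      contactHamiltonianField (extCotangentModel E) (canonicalContactForm E) H p = X ∧
      X.1.1 = leftMulDeriv p.1.proj 1 (functionalDeriv h (momentumMapHat E p)) ∧
      T X = liePoissonJacobiField E G h (momentumMapHat E p) := by
  obtain ⟨a, b, c, df, hX, hdf, ha, hb, hc⟩ :=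
    contactHamiltonianField_canonicalContactForm H p
  have hdf' : ∀ u, df u = fderiv ℝ h (momentumMapHat E p) (T u) := by
    have h1 := (hh.hasFDerivAt.hasMFDerivAt.comp p hT).mfderiv
    rw [← hHh] at h1
    intro u
    rw [hdf, h1]
    rfl
  set Dh := fderiv ℝ h (momentumMapHat E p) with hDh
  set δ : E := functionalDeriv h (momentumMapHat E p) with hδ
  have hDhδ : ∀ ν : E →L[ℝ] ℝ, Dh (ν, 0) = ν δ := fun ν => (apply_functionalDeriv h _ ν).symm
  have ha' : a = leftMulDeriv p.1.proj 1 δ := eq_of_forall_dual_apply_eq fun β => by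
    rw [ha, hdf', hT']
    simp only [map_zero, ContinuousLinearMap.comp_zero, add_zero]
    exact hDhδ _
  refine ⟨((a, b), c), hX, ha', ?_⟩
  have hJ := momentumMapHat_apply p
  have hb' : ∀ w, b w = -covector p.1
      (fderiv ℝ (leftFrame p.1.proj) (extChartAt 𝓘(ℝ, E) p.1.proj p.1.proj) w δ) -
      Dh (0, 1) * covector p.1 w := by
    intro w
    rw [hb, hdf', hdf', hT', hT']
    simp only [map_zero, ContinuousLinearMap.zero_comp, ContinuousLinearMap.comp_zero, zero_add]
    rw [hDhδ]
    rfl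
  rw [hT']
  refine Eq.trans ?_ (liePoissonJacobiField_eq (G := G) h (momentumMapHat E p)
    (b.comp (leftMulDeriv p.1.proj 1) + (covector p.1).comp
      (fderiv ℝ (leftFrame p.1.proj) (extChartAt 𝓘(ℝ, E) p.1.proj p.1.proj) a)) fun w => ?_).symm
  · refine Prod.ext rfl ?_
    change c = _
    rw [hc, hHh, ha']
    rfl
  -- The term `-H_x` of the fibre component and the derivative of the frame along the base component
  -- are the two halves of the bracket.
  · have hbr := congrArg (covector p.1) (leftMulDeriv_mlieBracket p.1.proj δ w)
    rw [map_sub, ← ha'] at hbr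
    refine Eq.trans ?_ (congrArg (· - Dh (0, 1) * covector p.1 (leftMulDeriv p.1.proj 1 w)) hbr.symm)
    rw [add_apply, ContinuousLinearMap.comp_apply, hb']
    simp only [ContinuousLinearMap.comp_apply]
    ring

lemma fieldsRelated_momentumMapHat {H : CotangentBundle E G × ℝ → ℝ}
    {h : DualLieAlgebra E G × ℝ → ℝ} (hHh : H = h ∘ momentumMapHat E)
    (hh : Differentiable ℝ h) :
    FieldsRelated (I := extCotangentModel E) (I' := 𝓘(ℝ, DualLieAlgebra E G × ℝ))
      (momentumMapHat E)
      (contactHamiltonianField (extCotangentModel E) (canonicalContactForm E) H)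
      (liePoissonJacobiField E G h) := by
  intro p
  obtain ⟨T, hT, hT'⟩ := exists_hasMFDerivAt_momentumMapHat p
  obtain ⟨X, hX, -, hTX⟩ := contactHamiltonianField_reduction hHh p (hh _) hT hT'
  refine ⟨hT.mdifferentiableAt, ?_⟩
  rw [hT.mfderiv, hX]
  exact hTX

/-- A tangent vector with the same base component and the same image by `T Ĵ` as `X_H` is `X_H`. -/
lemma eq_contactHamiltonianField {H : CotangentBundle E G × ℝ → ℝ}
    {h : DualLieAlgebra E G × ℝ → ℝ} (hHh : H = h ∘ momentumMapHat E) (hh : Differentiable ℝ h)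
    (p : CotangentBundle E G × ℝ) (u : (E × (E →L[ℝ] ℝ)) × ℝ)
    (hu : u.1.1 = leftMulDeriv p.1.proj 1 (functionalDeriv h (momentumMapHat E p)))
    (hJu : mfderiv (extCotangentModel E) 𝓘(ℝ, DualLieAlgebra E G × ℝ) (momentumMapHat E) p u =
      liePoissonJacobiField E G h (momentumMapHat E p)) :
    u = contactHamiltonianField (extCotangentModel E) (canonicalContactForm E) H p := by
  obtain ⟨T, hT, hT'⟩ := exists_hasMFDerivAt_momentumMapHat p
  obtain ⟨X, hX, hX1, hTX⟩ := contactHamiltonianField_reduction hHh p (hh _) hT hT'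
  rw [hX]
  rw [hT.mfderiv] at hJu
  have hTu : T u = T X := hJu.trans hTX.symm
  rw [hT', hT', hu, ← hX1] at hTu
  have h1 := congrArg Prod.fst hTu
  have h2 := congrArg Prod.snd hTu
  simp only [add_left_inj] at h1 h2
  -- The frame terms have cancelled because the base components agree; the derivative of left
  -- translation is invertible, so the fibre components agree too.
  have h3 := congrArg (fun L => L.comp (leftMulDeriv p.1.proj⁻¹ p.1.proj)) h1
  simp only [ContinuousLinearMap.comp_assoc, leftMulDeriv_comp_inv,
    ContinuousLinearMap.comp_id] at h3
  exact Prod.ext (Prod.ext (hu.trans hX1.symm) h3) h2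

set_option synthInstance.maxHeartbeats 400000 in
-- At the identity the bracket is the fixed bilinear map `D - D.flip`, so the field is an algebraic
-- expression in `μ`, `h` and the first derivatives of `h`. This regularity gives local existence
-- and uniqueness for `X_h`.
lemma contDiff_liePoissonJacobiField {h : DualLieAlgebra E G × ℝ → ℝ} (hh : ContDiff ℝ ∞ h) :
    ContDiff ℝ ∞ (fun x => (liePoissonJacobiField E G h x : DualLieAlgebra E G × ℝ)) := by
  let D : E →L[ℝ] E →L[ℝ] E := fderiv ℝ (leftFrame (1 : G)) (extChartAt 𝓘(ℝ, E) (1 : G) 1)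
  have h1 : ContDiff ℝ ∞ (fderiv ℝ h) := hh.fderiv_right (m := ∞) (by simp)
  have h2 : ContDiff ℝ ∞ (fun x => fderiv ℝ h x (0, 1)) := h1.clm_apply contDiff_const
  have hδ := contDiff_functionalDeriv hh
  have hΓ : ContDiff ℝ ∞ (fun x => (D - D.flip) (functionalDeriv h x)) :=
    (D - D.flip).contDiff.comp hδ
  have h3 : ContDiff ℝ ∞ (fun x : DualLieAlgebra E G × ℝ =>
      ((x.1.comp ((D - D.flip) (functionalDeriv h x) : E →L[ℝ] E) -
        fderiv ℝ h x (0, 1) • x.1 : E →L[ℝ] ℝ),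
        x.1 (functionalDeriv h x) - h x)) :=
    ((contDiff_fst.clm_comp hΓ).sub (h2.smul contDiff_fst)).prodMk
      ((contDiff_fst.clm_apply hδ).sub hh)
  refine (congrArg (ContDiff ℝ ∞) (funext fun x => ?_)).mpr h3
  refine liePoissonJacobiField_eq (G := G) h x _ fun w => ?_
  have hbr := leftMulDeriv_mlieBracket (1 : G) (functionalDeriv h x) w
  rw [leftMulDeriv_one_left] at hbr
  exact (congrArg (fun v => x.1 v - fderiv ℝ h x (0, 1) * x.1 w) hbr).symm

end Reduction

lemma comp_smulRight_one {V W : Type*} [NormedAddCommGroup V] [NormedSpace ℝ V]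
    [NormedAddCommGroup W] [NormedSpace ℝ W] (L : V →L[ℝ] W) (v : V) :
    L.comp ((1 : ℝ →L[ℝ] ℝ).smulRight v) = (1 : ℝ →L[ℝ] ℝ).smulRight (L v) := by
  ext; simp

/-! ### Curves in `G` with prescribed left velocity. -/

section LeftInvariantCurves

variable {E : Type*} [NormedAddCommGroup E] [NormedSpace ℝ E]
  {G : Type*} [TopologicalSpace G] [ChartedSpace E G] [Group G]

/-- At time `t`, the velocity of the curve `k` is the left translation of `ζ t`. -/
def HasLeftVelocity (ζ : ℝ → E) (k : ℝ → G) (t : ℝ) : Prop :=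
  HasMFDerivAt 𝓘(ℝ, ℝ) 𝓘(ℝ, E) k t
    ((1 : ℝ →L[ℝ] ℝ).smulRight (leftMulDeriv (E := E) (k t) 1 (ζ t)) : ℝ →L[ℝ] E)

lemma hasLeftVelocity_of_eq {ζ : ℝ → E} {k : ℝ → G} {t : ℝ} {g : G} (hg : k t = g)
    (h : HasMFDerivAt 𝓘(ℝ, ℝ) 𝓘(ℝ, E) k t
      ((1 : ℝ →L[ℝ] ℝ).smulRight (leftMulDeriv (E := E) g 1 (ζ t)) : ℝ →L[ℝ] E)) :
    HasLeftVelocity ζ k t := by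
  subst hg; exact h

variable [LieGroup 𝓘(ℝ, E) ∞ G] {ζ : ℝ → E}

lemma HasLeftVelocity.mul_left {k : ℝ → G} {t : ℝ} (hk : HasLeftVelocity ζ k t) (g : G) :
    HasLeftVelocity ζ (fun s => g * k s) t := by
  have hg : HasMFDerivAt 𝓘(ℝ, E) 𝓘(ℝ, E) (fun x : G => g * x) (k t)
      (leftMulDeriv (E := E) g (k t) : E →L[ℝ] E) :=
    ((contMDiff_mul_left (I := 𝓘(ℝ, E)) (n := ∞)).mdifferentiable (by simp) _).hasMFDerivAt
  have h := hg.comp t hk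
  rw [HasLeftVelocity, leftMulDeriv_mul, mul_one]
  exact h.congr_mfderiv (comp_smulRight_one (leftMulDeriv (E := E) g (k t)) _)

/-- A left translation makes the second curve meet the first at time `s`. The one-sided derivatives
there agree automatically, as both are the translate of `ζ s` to the same point. -/
lemma exists_hasLeftVelocity_glue {a b a' b' s : ℝ} {k k' : ℝ → G} (hs : s ∈ Ioo a b)
    (hs' : s ∈ Ioo a' b') (hk : ∀ t ∈ Ioo a b, HasLeftVelocity ζ k t)
    (hk' : ∀ t ∈ Ioo a' b', HasLeftVelocity ζ k' t) :
    ∃ l : ℝ → G, ∀ t ∈ Ioo a b', HasLeftVelocity ζ l t := by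
  set m : ℝ → G := fun t => k s * (k' s)⁻¹ * k' t with hm
  have hm' : ∀ t ∈ Ioo a' b', HasLeftVelocity ζ m t := fun t ht => (hk' t ht).mul_left _
  have hms : m s = k s := by simp [hm]
  refine ⟨fun t => if t ≤ s then k t else m t, fun t ht => ?_⟩
  rcases lt_trichotomy t s with hts | rfl | hts
  · have h := hk t ⟨ht.1, hts.trans hs.2⟩
    rw [HasLeftVelocity] at h ⊢
    simp only [hts.le, if_true]
    refine h.congr_of_eventuallyEq ?_
    filter_upwards [Iio_mem_nhds hts] with r hr
    rw [if_pos (le_of_lt hr)]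
  · have h1 := (hk t hs).hasMFDerivWithinAt (s := Iic t)
    have h2 := (hm' t hs').hasMFDerivWithinAt (s := Ici t)
    rw [hms] at h2
    refine hasLeftVelocity_of_eq (g := k t) (if_pos le_rfl)
      (hasMFDerivWithinAt_univ.1 (Iic_union_Ici (a := t) ▸ HasMFDerivWithinAt.union ?_ ?_))
    · refine h1.congr_of_eventuallyEq ?_ (by simp)
      filter_upwards [self_mem_nhdsWithin] with r hr
      exact if_pos hr
    · refine h2.congr_of_eventuallyEq ?_ (by simp [hms])
      filter_upwards [self_mem_nhdsWithin] with r hr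
      rcases eq_or_lt_of_le (mem_Ici.1 hr) with rfl | hr'
      · simp [hms]
      · exact if_neg (not_le.2 hr')
  · have h := hm' t ⟨hs'.1.trans hts, ht.2⟩
    rw [HasLeftVelocity] at h ⊢
    simp only [not_le.2 hts, if_false]
    refine h.congr_of_eventuallyEq ?_
    filter_upwards [Ioi_mem_nhds hts] with r hr
    rw [if_neg (not_le.2 hr)]

/-- Left translation turns local existence of curves with a prescribed left velocity into existence
on a whole interval. -/
lemma exists_hasLeftVelocity_of_local {a b : ℝ}
    (hloc : ∀ s ∈ Ioo a b, ∃ k : ℝ → G, ∀ᶠ t in nhds s, HasLeftVelocity ζ k t)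
    {s s' : ℝ} (hs : s ∈ Ioo a b) (hs' : s' ∈ Ioo a b) (g : G) :
    ∃ (k : ℝ → G) (a' b' : ℝ), s ∈ Ioo a' b' ∧ s' ∈ Ioo a' b' ∧ k s = g ∧
      ∀ t ∈ Ioo a' b', HasLeftVelocity ζ k t := by
  let P : ℝ → ℝ → Prop := fun s s' => ∃ (k : ℝ → G) (a' b' : ℝ), s ∈ Ioo a' b' ∧ s' ∈ Ioo a' b' ∧
      ∀ t ∈ Ioo a' b', HasLeftVelocity ζ k t
  have hP : P s s' := by
    refine isPreconnected_Ioo.induction₂ P ?_ ?_ ?_ hs hs'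
    · intro x hx
      obtain ⟨k, hk⟩ := hloc x hx
      obtain ⟨l, u, hlu, hk'⟩ := mem_nhds_iff_exists_Ioo_subset.1 hk
      filter_upwards [mem_nhdsWithin_of_mem_nhds (Ioo_mem_nhds hlu.1 hlu.2)] with y hy
      exact ⟨k, l, u, hlu, hy, fun t ht => hk' ht⟩
    · rintro x y z - - - ⟨k, a₁, b₁, hx, hy, hk⟩ ⟨k', a₂, b₂, hy', hz, hk'⟩
      -- Gluing is needed only when `y` lies between `x` and `z`; otherwise one of the two intervals
      -- already contains both `x` and `z`.
      rcases le_total x y with hxy | hxy <;> rcases le_total y z with hyz | hyz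
      · obtain ⟨l, hl⟩ := exists_hasLeftVelocity_glue hy hy' hk hk'
        exact ⟨l, a₁, b₂, ⟨hx.1, (hxy.trans hyz).trans_lt hz.2⟩,
          ⟨hx.1.trans_le (hxy.trans hyz), hz.2⟩, hl⟩
      · rcases le_total x z with hxz | hxz
        · exact ⟨k, a₁, b₁, hx, ⟨hx.1.trans_le hxz, hyz.trans_lt hy.2⟩, hk⟩
        · exact ⟨k', a₂, b₂, ⟨hz.1.trans_le hxz, hxy.trans_lt hy'.2⟩, hz, hk'⟩
      · rcases le_total x z with hxz | hxz
        · exact ⟨k', a₂, b₂, ⟨hy'.1.trans_le hxy, hxz.trans_lt hz.2⟩, hz, hk'⟩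
        · exact ⟨k, a₁, b₁, hx, ⟨hy.1.trans_le hyz, hxz.trans_lt hx.2⟩, hk⟩
      · obtain ⟨l, hl⟩ := exists_hasLeftVelocity_glue hy' hy hk' hk
        exact ⟨l, a₂, b₁, ⟨hz.1.trans_le (hyz.trans hxy), hx.2⟩,
          ⟨hz.1, (hyz.trans hxy).trans_lt hx.2⟩, hl⟩
    · rintro x y - - ⟨k, a₁, b₁, hx, hy, hk⟩
      exact ⟨k, a₁, b₁, hy, hx, hk⟩
  obtain ⟨k, a', b', h1, h2, hk⟩ := hP
  exact ⟨fun t => g * (k s)⁻¹ * k t, a', b', h1, h2, by simp, fun t ht => (hk t ht).mul_left _⟩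

end LeftInvariantCurves

/-! ### Local solutions of the reconstruction equation. -/

section Lifting

variable {E : Type*} [NormedAddCommGroup E] [NormedSpace ℝ E] [FiniteDimensional ℝ E]
  {G : Type*} [TopologicalSpace G] [ChartedSpace E G] [Group G] [LieGroup 𝓘(ℝ, E) ∞ G]

omit [FiniteDimensional ℝ E] in
/-- A curve in the chart around `1` solving the equation of left invariant curves. -/
lemma hasLeftVelocity_of_hasDerivAt {ζ : ℝ → E} {y : ℝ → E} {t : ℝ}
    (ht : y t ∈ (extChartAt 𝓘(ℝ, E) (1 : G)).target)
    (hy : HasDerivAt y (leftFrame (1 : G) (y t) (ζ t)) t) :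
    HasLeftVelocity ζ (fun s => (extChartAt 𝓘(ℝ, E) (1 : G)).symm (y s)) t := by
  have hd : HasMFDerivWithinAt 𝓘(ℝ, E) 𝓘(ℝ, E) (extChartAt 𝓘(ℝ, E) (1 : G)).symm
      (range 𝓘(ℝ, E)) (y t) _ :=
    (mdifferentiableWithinAt_extChartAt_symm ht).hasMFDerivWithinAt
  set k := (extChartAt 𝓘(ℝ, E) (1 : G)).symm (y t) with hk
  have hks : k ∈ (chartAt E (1 : G)).source := by
    have := (extChartAt 𝓘(ℝ, E) (1 : G)).map_target ht
    rwa [extChartAt_source] at this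
  have hyk : extChartAt 𝓘(ℝ, E) (1 : G) k = y t := (extChartAt 𝓘(ℝ, E) (1 : G)).right_inv ht
  have hD := chartSymmDeriv_eq (E := E) hks
  have hF := chartSymmDeriv_comp_leftFrame (E := E) hks
  rw [hyk] at hD hF
  rw [ModelWithCorners.range_eq_univ] at hd hD
  rw [hasMFDerivWithinAt_univ, ← hD] at hd
  have h := hd.comp t hy.hasFDerivAt.hasMFDerivAt
  rw [HasLeftVelocity, ← hk, ← hF]
  exact h.congr_mfderiv (comp_smulRight_one (chartSymmDeriv (E := E) (1 : G) k) _)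

/-- The equation for `k` depends on time through `c`. Coupling it with the equation of `c` gives an
autonomous `C^1` system, to which the local existence theorem applies. -/
lemma exists_local_hasLeftVelocity {h : DualLieAlgebra E G × ℝ → ℝ} (hh : ContDiff ℝ ∞ h)
    {c : ℝ → DualLieAlgebra E G × ℝ} {s : ℝ}
    (hc : IsMIntegralCurveAt c (liePoissonJacobiField E G h) s) :
    ∃ k : ℝ → G, ∀ᶠ t in nhds s, HasLeftVelocity (fun t => functionalDeriv h (c t)) k t := by
  have hX := contDiff_liePoissonJacobiField (G := G) hh
  let F : E × ((E →L[ℝ] ℝ) × ℝ) → E × ((E →L[ℝ] ℝ) × ℝ) := fun w =>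
    (leftFrame (1 : G) w.1 (functionalDeriv h w.2), liePoissonJacobiField E G h w.2)
  have hF : ContDiffAt ℝ 1 F (extChartAt 𝓘(ℝ, E) (1 : G) 1, c s) := by
    refine ContDiffAt.prodMk (ContDiffAt.clm_apply ?_ ?_) ?_
    · have h1 : ContDiffAt ℝ 2 (leftFrame (1 : G)) (extChartAt 𝓘(ℝ, E) (1 : G) 1) :=
        (contDiffOn_leftFrame (E := E) (1 : G)).contDiffAt (extChartAt_target_mem_nhds (1 : G))
      exact ContDiffAt.comp (extChartAt 𝓘(ℝ, E) (1 : G) 1, c s)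
        (h1.of_le (m := 1) (by norm_num)) contDiffAt_fst
    · exact ((contDiff_functionalDeriv hh).comp contDiff_snd).contDiffAt.of_le (by simp)
    · exact (hX.comp contDiff_snd).contDiffAt.of_le (by simp)
  obtain ⟨α, hα0, ε, hε, hα⟩ :=
    hF.exists_forall_mem_closedBall_exists_eq_forall_mem_Ioo_hasDerivAt₀ s
  refine ⟨fun t => (extChartAt 𝓘(ℝ, E) (1 : G)).symm (α t).1, ?_⟩
  have hI : ∀ᶠ t in nhds s, t ∈ Ioo (s - ε) (s + ε) := Ioo_mem_nhds (by linarith) (by linarith)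
  have hα2 : IsMIntegralCurveAt (fun t => (α t).2) (liePoissonJacobiField E G h) s := by
    filter_upwards [hI] with t ht
    have := (ContinuousLinearMap.snd ℝ E ((E →L[ℝ] ℝ) × ℝ)).hasFDerivAt.comp_hasDerivAt t (hα t ht)
    exact this.hasFDerivAt.hasMFDerivAt
  -- The second component solves the equation of `c` with the same initial value, so uniqueness lets
  -- `c` replace it.
  have heq : (fun t => (α t).2) =ᶠ[nhds s] c := by
    refine isMIntegralCurveAt_eventuallyEq_of_contMDiffAt_boundaryless ?_ hα2 hc (by simp [hα0])
    exact contMDiffAt_vectorSpace_iff_contDiffAt.2 (hX.contDiffAt.of_le (by simp))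
  have hcont : ContinuousAt (fun t => (α t).1) s :=
    (hα s ⟨by linarith, by linarith⟩).continuousAt.fst
  have htgt : ∀ᶠ t in nhds s, (α t).1 ∈ (extChartAt 𝓘(ℝ, E) (1 : G)).target :=
    hcont.eventually_mem (by simpa [hα0] using extChartAt_target_mem_nhds (I := 𝓘(ℝ, E)) (1 : G))
  filter_upwards [hI, heq, htgt] with t ht hte htt
  refine hasLeftVelocity_of_hasDerivAt htt ?_
  rw [← hte]
  exact (ContinuousLinearMap.fst ℝ E ((E →L[ℝ] ℝ) × ℝ)).hasFDerivAt.comp_hasDerivAt t (hα t ht)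

end Lifting

/-! ### Lifted curves through the left trivialization of `T^*G × ℝ`. -/

section LiftedCurves

variable {E : Type*} [NormedAddCommGroup E] [NormedSpace ℝ E]
  {G : Type*} [TopologicalSpace G] [ChartedSpace E G] [Group G] [LieGroup 𝓘(ℝ, E) ∞ G]

/-- The inverse of the left trivialization of `T^*G × ℝ`: the point over `g` whose image by `Ĵ`
is `x`. -/
def ofLeftTrivialization (g : G) (x : DualLieAlgebra E G × ℝ) : CotangentBundle E G × ℝ :=
  (⟨g, (x.1.comp (leftMulDeriv g⁻¹ g) : E →L[ℝ] ℝ)⟩, x.2)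

lemma momentumMapHat_ofLeftTrivialization (g : G) (x : DualLieAlgebra E G × ℝ) :
    momentumMapHat E (ofLeftTrivialization g x) = x := by
  refine Prod.ext ?_ rfl
  change (x.1.comp (leftMulDeriv g⁻¹ g)).comp (leftMulDeriv g 1) = x.1
  rw [ContinuousLinearMap.comp_assoc, leftMulDeriv_inv_comp, ContinuousLinearMap.comp_id]

lemma ofLeftTrivialization_momentumMapHat (p : CotangentBundle E G × ℝ) :
    ofLeftTrivialization p.1.proj (momentumMapHat E p) = p := by
  have h : ((covector p.1).comp (leftMulDeriv p.1.proj 1)).comp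
      (leftMulDeriv p.1.proj⁻¹ p.1.proj) = covector p.1 := by
    rw [ContinuousLinearMap.comp_assoc, leftMulDeriv_comp_inv, ContinuousLinearMap.comp_id]
  exact congrArg (fun α : E →L[ℝ] ℝ => ((⟨p.1.proj, α⟩, p.2) : CotangentBundle E G × ℝ)) h

lemma inverse_leftFrame {g k : G} (hk : k ∈ (chartAt E g).source) :
    (leftFrame g (extChartAt 𝓘(ℝ, E) g k)).inverse =
      (leftMulDeriv k⁻¹ k).comp (chartSymmDeriv g k) := by
  rw [leftFrame_extChartAt hk]
  refine ContinuousLinearMap.inverse_eq ?_ ?_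
  · rw [ContinuousLinearMap.comp_assoc, ← ContinuousLinearMap.comp_assoc (leftMulDeriv k 1),
      leftMulDeriv_comp_inv, ContinuousLinearMap.id_comp, chartDeriv_comp_chartSymmDeriv hk]
  · rw [ContinuousLinearMap.comp_assoc, ← ContinuousLinearMap.comp_assoc (chartSymmDeriv g k),
      chartSymmDeriv_comp_chartDeriv hk, ContinuousLinearMap.id_comp, leftMulDeriv_inv_comp]

variable [FiniteDimensional ℝ E]

/-- In the trivialization around `k t` the fibre coordinate is `μ` composed with the inverse of the
left frame along `k`, and operator inversion is smooth at an invertible operator. -/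
lemma mdifferentiableAt_ofLeftTrivialization {k : ℝ → G} {c : ℝ → DualLieAlgebra E G × ℝ} {t : ℝ}
    (hk : MDifferentiableAt 𝓘(ℝ, ℝ) 𝓘(ℝ, E) k t) (hc : DifferentiableAt ℝ c t) :
    MDifferentiableAt 𝓘(ℝ, ℝ) (extCotangentModel E) (fun s => ofLeftTrivialization (k s) (c s)) t := by
  refine MDifferentiableAt.prodMk ?_ hc.snd.mdifferentiableAt
  rw [mdifferentiableAt_totalSpace]
  refine ⟨hk, ?_⟩
  have hφk : DifferentiableAt ℝ (fun s => extChartAt 𝓘(ℝ, E) (k t) (k s)) t :=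
    ((mdifferentiableAt_extChartAt (I := 𝓘(ℝ, E)) (mem_chart_source E (k t))).comp t
      hk).differentiableAt
  have hA : DifferentiableAt ℝ (leftFrame (k t)) (extChartAt 𝓘(ℝ, E) (k t) (k t)) :=
    ((contDiffOn_leftFrame (k t)).contDiffAt
      (extChartAt_target_mem_nhds (k t))).differentiableAt (by simp)
  have hinv : DifferentiableAt ℝ (fun s =>
      (leftFrame (k t) (extChartAt 𝓘(ℝ, E) (k t) (k s))).inverse) t := by
    have h1 : DifferentiableAt ℝ (fun s => leftFrame (k t) (extChartAt 𝓘(ℝ, E) (k t) (k s))) t :=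
      DifferentiableAt.comp (g := leftFrame (k t)) t hA hφk
    let e : E ≃L[ℝ] E := ContinuousLinearEquiv.equivOfInverse'
      (leftMulDeriv (k t) 1) (leftMulDeriv (k t)⁻¹ (k t)) (leftMulDeriv_comp_inv (k t))
        (leftMulDeriv_inv_comp (k t))
    have h2 : DifferentiableAt ℝ (ContinuousLinearMap.inverse (R := ℝ) (M := E) (M₂ := E))
        (leftFrame (k t) (extChartAt 𝓘(ℝ, E) (k t) (k t))) := by
      rw [leftFrame_extChartAt_self]
      exact (contDiffAt_map_inverse (n := 1) e).differentiableAt (by simp)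
    exact DifferentiableAt.comp t h2 h1
  have h3 : DifferentiableAt ℝ (fun s => (c s).1.comp
      (leftFrame (k t) (extChartAt 𝓘(ℝ, E) (k t) (k s))).inverse) t := hc.fst.clm_comp hinv
  refine h3.mdifferentiableAt.congr_of_eventuallyEq ?_
  filter_upwards [hk.continuousAt.preimage_mem_nhds (chart_source_mem_nhds E (k t))] with s hs
  refine (congrArg Prod.snd (extChartAt_cotangentBundle_apply
    (ofLeftTrivialization (k t) (c t)).1 (ofLeftTrivialization (k s) (c s)).1)).trans ?_
  change ((c s).1.comp (leftMulDeriv (k s)⁻¹ (k s))).comp (chartSymmDeriv (k t) (k s)) = _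
  rw [inverse_leftFrame hs, ContinuousLinearMap.comp_assoc]

/-- Once differentiability is known, the velocity is found without computing its fibre component:
the base projection of the curve is `k`, its image by `Ĵ` is `c`, and these data characterize `X_H`.
-/
lemma hasMFDerivAt_ofLeftTrivialization {H : CotangentBundle E G × ℝ → ℝ}
    {h : DualLieAlgebra E G × ℝ → ℝ} (hHh : H = h ∘ momentumMapHat E) (hh : Differentiable ℝ h)
    {k : ℝ → G} {c : ℝ → DualLieAlgebra E G × ℝ} {t : ℝ}
    (hk : HasLeftVelocity (fun s => functionalDeriv h (c s)) k t)
    (hc : HasMFDerivAt 𝓘(ℝ, ℝ) 𝓘(ℝ, DualLieAlgebra E G × ℝ) c t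
      ((1 : ℝ →L[ℝ] ℝ).smulRight (liePoissonJacobiField E G h (c t)))) :
    HasMFDerivAt 𝓘(ℝ, ℝ) (extCotangentModel E) (fun s => ofLeftTrivialization (k s) (c s)) t
      ((1 : ℝ →L[ℝ] ℝ).smulRight (contactHamiltonianField (extCotangentModel E)
        (canonicalContactForm E) H (ofLeftTrivialization (k t) (c t)))) := by
  have hd := (mdifferentiableAt_ofLeftTrivialization hk.mdifferentiableAt
    hc.mdifferentiableAt.differentiableAt).hasMFDerivAt
  set γ : ℝ → CotangentBundle E G × ℝ := fun s => ofLeftTrivialization (k s) (c s) with hγ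
  obtain ⟨D, hD⟩ : ∃ D : ℝ →L[ℝ] (E × (E →L[ℝ] ℝ)) × ℝ,
    mfderiv 𝓘(ℝ, ℝ) (extCotangentModel E) γ t = D := ⟨_, rfl⟩
  have hJ : ∀ s, momentumMapHat E (γ s) = c s := fun s => momentumMapHat_ofLeftTrivialization _ _
  have h1 : (D 1).1.1 = leftMulDeriv (k t) 1 (functionalDeriv h (c t)) := by
    have hp := (hasMFDerivAt_cotangentBundle_proj (γ t).1).comp t
      ((hasMFDerivAt_fst (I := cotangentModel E) (I' := 𝓘(ℝ, ℝ)) (x := γ t)).comp t hd)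
    have h' := DFunLike.congr_fun (hasMFDerivAt_unique hp hk) (1 : ℝ)
    rw [hD] at h'
    refine Eq.trans h' ?_
    exact one_smul ℝ (leftMulDeriv (E := E) (k t) 1 (functionalDeriv h (c t)))
  have h2 : mfderiv (extCotangentModel E) 𝓘(ℝ, DualLieAlgebra E G × ℝ) (momentumMapHat E) (γ t)
      (D 1) = liePoissonJacobiField E G h (momentumMapHat E (γ t)) := by
    obtain ⟨T, hT, -⟩ := exists_hasMFDerivAt_momentumMapHat (γ t)
    have hp := hT.comp t hd
    have hcomp : momentumMapHat E ∘ γ = c := funext hJ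
    rw [hcomp] at hp
    have h' := DFunLike.congr_fun (hasMFDerivAt_unique hp hc) (1 : ℝ)
    rw [hD] at h'
    rw [hT.mfderiv, hJ]
    refine Eq.trans h' ?_
    exact one_smul ℝ (liePoissonJacobiField E G h (c t))
  have h3 := eq_contactHamiltonianField hHh hh (γ t) (D 1) (by rw [hJ]; exact h1) h2
  refine hd.congr_mfderiv ?_
  rw [hD]
  change D = (1 : ℝ →L[ℝ] ℝ).smulRight (contactHamiltonianField (extCotangentModel E)
        (canonicalContactForm E) H (γ t))
  rw [← h3]
  refine ContinuousLinearMap.ext fun r => ?_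
  have : D r = r • D 1 := by rw [← map_smul, smul_eq_mul, mul_one]
  exact this

end LiftedCurves

/-! ### Comparison of the flows. -/

section Flows

variable {E : Type*} [NormedAddCommGroup E] [NormedSpace ℝ E] [FiniteDimensional ℝ E]
  {G : Type*} [TopologicalSpace G] [ChartedSpace E G] [Group G] [LieGroup 𝓘(ℝ, E) ∞ G]

lemma IsFlowCurve.momentumMapHat_comp {H : CotangentBundle E G × ℝ → ℝ}
    {h : DualLieAlgebra E G × ℝ → ℝ} (hHh : H = h ∘ momentumMapHat E) (hh : Differentiable ℝ h)
    {t : ℝ} {p : CotangentBundle E G × ℝ} {γ : ℝ → CotangentBundle E G × ℝ}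
    (hγ : IsFlowCurve
      (contactHamiltonianField (extCotangentModel E) (canonicalContactForm E) H) t p γ) :
    IsFlowCurve (liePoissonJacobiField E G h) t (momentumMapHat E p) (momentumMapHat E ∘ γ) := by
  obtain ⟨a, b, h0, ht, hp, hγ⟩ := hγ
  refine ⟨a, b, h0, ht, congrArg _ hp, fun s hs => ?_⟩
  obtain ⟨hd, hX⟩ := fieldsRelated_momentumMapHat hHh hh (γ s)
  have h1 := hd.hasMFDerivAt.comp_hasMFDerivWithinAt s (hγ s hs)
  refine h1.congr_mfderiv ?_
  change _ = (1 : ℝ →L[ℝ] ℝ).smulRight (liePoissonJacobiField E G h (momentumMapHat E (γ s)))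
  rw [← hX]
  exact comp_smulRight_one (V := (E × (E →L[ℝ] ℝ)) × ℝ) (W := DualLieAlgebra E G × ℝ)
    (mfderiv (extCotangentModel E) 𝓘(ℝ, DualLieAlgebra E G × ℝ) (momentumMapHat E) (γ s)) _

lemma exists_isFlowCurve_lift {H : CotangentBundle E G × ℝ → ℝ}
    {h : DualLieAlgebra E G × ℝ → ℝ} (hHh : H = h ∘ momentumMapHat E) (hh : ContDiff ℝ ∞ h)
    {t : ℝ} {p : CotangentBundle E G × ℝ} {c : ℝ → DualLieAlgebra E G × ℝ}
    (hc : IsFlowCurve (liePoissonJacobiField E G h) t (momentumMapHat E p) c) :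
    ∃ γ, IsFlowCurve
      (contactHamiltonianField (extCotangentModel E) (canonicalContactForm E) H) t p γ := by
  obtain ⟨a, b, h0, ht, hp, hc⟩ := hc
  obtain ⟨k, a', b', h0', ht', hk0, hk⟩ := exists_hasLeftVelocity_of_local
    (ζ := fun s => functionalDeriv h (c s)) (fun s hs => exists_local_hasLeftVelocity hh
      (hc.isMIntegralCurveAt (Ioo_mem_nhds hs.1 hs.2))) h0 ht p.1.proj
  -- The interval of `k` need not lie inside that of `c`; their intersection still contains `0` and
  -- `t`.
  refine ⟨fun s => ofLeftTrivialization (k s) (c s), max a a', min b b',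
    ⟨max_lt h0.1 h0'.1, lt_min h0.2 h0'.2⟩, ⟨max_lt ht.1 ht'.1, lt_min ht.2 ht'.2⟩, ?_, ?_⟩
  · simp only [hk0, hp]
    exact ofLeftTrivialization_momentumMapHat p
  · intro s hs
    have hs1 : s ∈ Ioo a b := ⟨(le_max_left _ _).trans_lt hs.1, hs.2.trans_le (min_le_left _ _)⟩
    have hs2 : s ∈ Ioo a' b' := ⟨(le_max_right _ _).trans_lt hs.1, hs.2.trans_le (min_le_right _ _)⟩
    exact (hasMFDerivAt_ofLeftTrivialization hHh (hh.differentiable (by simp)) (hk s hs2)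
      ((hc s hs1).hasMFDerivAt (Ioo_mem_nhds hs1.1 hs1.2))).hasMFDerivWithinAt

lemma IsFlowCurve.eq_liePoissonJacobiField {h : DualLieAlgebra E G × ℝ → ℝ} (hh : ContDiff ℝ ∞ h)
    {t : ℝ} {x : DualLieAlgebra E G × ℝ} {c c' : ℝ → DualLieAlgebra E G × ℝ}
    (hc : IsFlowCurve (liePoissonJacobiField E G h) t x c)
    (hc' : IsFlowCurve (liePoissonJacobiField E G h) t x c') : c t = c' t := by
  obtain ⟨a, b, h0, ht, hx, hc⟩ := hc
  obtain ⟨a', b', h0', ht', hx', hc'⟩ := hc'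
  refine isMIntegralCurveOn_Ioo_eqOn_of_contMDiff_boundaryless (a := max a a') (b := min b b')
    ⟨max_lt h0.1 h0'.1, lt_min h0.2 h0'.2⟩ ?_ (hc.mono ?_) (hc'.mono ?_) (hx.trans hx'.symm)
    ⟨max_lt ht.1 ht'.1, lt_min ht.2 ht'.2⟩
  · exact contMDiff_vectorSpace_iff_contDiff.2 ((contDiff_liePoissonJacobiField hh).of_le (by simp))
  · exact Ioo_subset_Ioo (le_max_left _ _) (min_le_left _ _)
  · exact Ioo_subset_Ioo (le_max_right _ _) (min_le_right _ _)

end Flows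

end

theorem mainTheorem3
    {E : Type*} [NormedAddCommGroup E] [NormedSpace ℝ E] [FiniteDimensional ℝ E]
    {G : Type*} [TopologicalSpace G] [ChartedSpace E G] [Group G] [LieGroup 𝓘(ℝ, E) ∞ G]
    [T2Space G]
    (H : CotangentBundle E G × ℝ → ℝ)
    (hH : ContMDiff (extCotangentModel E) 𝓘(ℝ, ℝ) ∞ H)
    (hinv : ∀ (g : G) (p : CotangentBundle E G × ℝ), H (cotangentLiftAction E g p) = H p) :
    -- the reduced Hamiltonian is smooth, and `H = h ∘ Ĵ`
    ContDiff ℝ ∞ (restrictToIdentity E H) ∧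
    H = restrictToIdentity E H ∘ momentumMapHat E ∧
    -- the fields `X_H` and `X_h` are `Ĵ`-related
    FieldsRelated (I := extCotangentModel E) (I' := 𝓘(ℝ, DualLieAlgebra E G × ℝ))
      (momentumMapHat E)
      (contactHamiltonianField (extCotangentModel E) (canonicalContactForm E) H)
      (liePoissonJacobiField E G (restrictToIdentity E H)) ∧
    -- `Ĵ ∘ φ_t^{X_H} = φ_t^{X_h} ∘ Ĵ`, as an equality of partially defined maps
    ∀ (t : ℝ) (p : CotangentBundle E G × ℝ),
      (flow (contactHamiltonianField (extCotangentModel E) (canonicalContactForm E) H) t p).map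
          (momentumMapHat E) =
        flow (liePoissonJacobiField E G (restrictToIdentity E H)) t (momentumMapHat E p) := by
  have hh : ContDiff ℝ ∞ (restrictToIdentity E H) := contDiff_restrictToIdentity hH
  have hd : Differentiable ℝ (restrictToIdentity E H) := hh.differentiable (by simp)
  have hHh : H = restrictToIdentity E H ∘ momentumMapHat E :=
    eq_restrictToIdentity_comp_momentumMapHat hinv
  refine ⟨hh, hHh, fieldsRelated_momentumMapHat hHh hd, fun t p => Part.ext' ⟨?_, ?_⟩ ?_⟩
  · rintro ⟨γ, hγ⟩
    exact ⟨_, hγ.momentumMapHat_comp hHh hd⟩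
  · rintro ⟨c, hc⟩
    exact exists_isFlowCurve_lift hHh hh hc
  · intro h₁ h₂
    -- The curves chosen by the two flows are unrelated, but the image of the first and the second
    -- are both integral curves of `X_h` with the same initial point.
    exact ((Classical.choose_spec h₁).momentumMapHat_comp hHh hd).eq_liePoissonJacobiField hh
      (Classical.choose_spec h₂)
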